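/- An effect algebra is a partial algebra $(E;+,0,1)$ with a partial binary operation $+$ and elements $0,1\in E$ such that, for all $a,b,c\in E$: (i) $a+b$ is defined iff $b+a$ is, and then $a+b=b+a$; (ii) $a+b$ and $(a+b)+c$ are defined iff $b+c$ and $a+(b+c)$ are defined, and then $(a+b)+c=a+(b+c)$; (iii) there is a unique $a'\in E$ with $a+a'=1$; (iv) if $a+1$ is defined, then $a=0$. It is partially ordered by $a\le b$ iff $a+c=b$ for some $c\in E$, and it is a $\sigma$-lattice effect algebra if every countable family of elements has a join and a meet in this order. An observable on $E$ is a map $x:\mathcal B(\mathbb R)\to E$ on the Borel sets of $\mathbb R$ such that $x(\mathbb R)=1$; if $A\cap B=\emptyset$, then $x(A)+x(B)$ is defined and equals $x(A\cup B)$; and if $A_1\subseteq A_2\subseteq\cdots$, then $x(\bigcup_i A_i)=\bigvee_i x(A_i)$. **Theorem.** Let $E$ be a $\sigma$-lattice effect algebra. Let $x$ be an observable on $E$ and put $$x_t:=x((-\infty,t]),\qquad t\in\mathbb R. \tag{1}$$ Then $$x_t\le x_s\quad\text{if } t<s, \tag{2}$$ $$\bigwedge_{t\in\mathbb R} x_t=0,\qquad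 \bigvee_{t\in\mathbb R} x_t=1, \tag{3}$$ $$\bigwedge_{t>s}x_t=x_s,\qquad s\in\mathbb R, \tag{4}$$ where the existence of these meets and joins in $E$ is part of the claim. Conversely, for every system $\{x_t:t\in\mathbb R\}$ of elements of $E$ for which (2)–(4) hold (the meets and joins exist and have these values), there is a unique observable $x$ on $E$ such that (1) holds for all $t\in\mathbb R$. -/

import Mathlib

/-- An effect algebra: a partial algebra `(E; +, 0, 1)`. The partial operation is `padd`, where
`padd a b = some c` means that `a + b` is defined and equal to `c`, and `padd a b = none` means that
`a + b` is undefined. Equalities between values of `Option E` say that one side is defined iff the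
other one is, and that the values then agree. -/
class EffectAlgebra (E : Type*) extends Zero E, One E where
  padd : E → E → Option E
  padd_comm : ∀ a b : E, padd a b = padd b a
  /-- `(a + b) + c = a + (b + c)`, with one side defined iff the other one is. -/
  padd_assoc : ∀ a b c : E,
    ((padd a b).bind fun d => padd d c) = ((padd b c).bind fun d => padd a d)
  /-- Every element has a unique orthosupplement. -/
  existsUnique_compl : ∀ a : E, ∃! b : E, padd a b = some 1
  /-- If `a + 1` is defined, then `a = 0`. -/
  eq_zero_of_padd_one : ∀ a : E, (padd a 1).isSome → a = 0

namespace EffectAlgebra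

variable {E : Type*} [EffectAlgebra E]

theorem assoc_right {a b c d e : E} (h1 : padd a b = some d) (h2 : padd d c = some e) :
    ∃ f, padd b c = some f ∧ padd a f = some e := by
  have h := padd_assoc a b c
  rw [h1, Option.bind_some, h2] at h
  exact Option.bind_eq_some_iff.mp h.symm

theorem padd_zero (a : E) : padd a 0 = some a := by
  have h10 : padd (1 : E) 0 = some 1 := by
    obtain ⟨b, hb, -⟩ := existsUnique_compl (1 : E)
    have hb0 : b = 0 := eq_zero_of_padd_one b (by rw [padd_comm, hb]; rfl)
    rwa [hb0] at hb
  obtain ⟨b, hb, -⟩ := existsUnique_compl a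
  have hba : padd b a = some 1 := by rw [padd_comm, hb]
  obtain ⟨f, hf, hbf⟩ := assoc_right hba h10
  rw [hf, (existsUnique_compl b).unique hbf hba]

/-- The order of an effect algebra: `a ≤ b` iff `a + c = b` for some `c`. -/
instance : PartialOrder E where
  le a b := ∃ c : E, padd a c = some b
  le_refl a := ⟨0, padd_zero a⟩
  le_trans a b c := by
    rintro ⟨d, hd⟩ ⟨e, he⟩
    obtain ⟨f, -, hf⟩ := assoc_right hd he
    exact ⟨f, hf⟩
  le_antisymm a b := by
    rintro ⟨c, hc⟩ ⟨d, hd⟩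
    obtain ⟨f, hf, haf⟩ := assoc_right hc hd
    -- cancel `a` in `a + f = a`
    obtain ⟨a', ha', -⟩ := existsUnique_compl a
    have hfa : padd f a = some a := by rw [padd_comm, haf]
    obtain ⟨g, hg, hfg⟩ := assoc_right hfa ha'
    have hg1 : g = 1 := by rw [ha'] at hg; exact (Option.some.inj hg).symm
    have hf0 : f = 0 := eq_zero_of_padd_one f (by rw [← hg1, hfg]; rfl)
    -- `c + d = 0` forces `c = 0`
    have h01 : padd (0 : E) 1 = some 1 := by rw [padd_comm, padd_zero]
    rw [hf0, padd_comm] at hf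
    obtain ⟨k, hk, -⟩ := assoc_right hf h01
    have hc0 : c = 0 := eq_zero_of_padd_one c (by rw [hk]; rfl)
    rw [hc0, padd_zero] at hc
    exact Option.some.inj hc

end EffectAlgebra

/-- An effect algebra is a `σ`-lattice if, in its order, every countable family of elements has a
join and a meet. (Finite families are covered by repeating elements.) -/
class IsSigmaLatticeEffectAlgebra (E : Type*) [EffectAlgebra E] : Prop where
  exists_isLUB : ∀ a : ℕ → E, ∃ s, IsLUB (Set.range a) s
  exists_isGLB : ∀ a : ℕ → E, ∃ s, IsGLB (Set.range a) s

/-- An observable on an effect algebra `E`: a map from the Borel sets of `ℝ` to `E` (given as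
`A ↦ x A hA`, where `hA` says that `A` is Borel) which is normalized, additive on disjoint sets, and
preserves unions of increasing sequences. -/
@[ext]
structure Observable (E : Type*) [EffectAlgebra E] where
  toFun : ∀ A : Set ℝ, MeasurableSet A → E
  map_univ : toFun Set.univ MeasurableSet.univ = 1
  /-- If `A ∩ B = ∅`, then `x(A) + x(B)` is defined and equal to `x(A ∪ B)`. -/
  map_union : ∀ (A B : Set ℝ) (hA : MeasurableSet A) (hB : MeasurableSet B), A ∩ B = ∅ →
    EffectAlgebra.padd (toFun A hA) (toFun B hB) = some (toFun (A ∪ B) (hA.union hB))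
  /-- If `A 0 ⊆ A 1 ⊆ ⋯`, then `x(⋃ i, A i)` is the join of the elements `x(A i)`. -/
  map_iUnion : ∀ (A : ℕ → Set ℝ) (hA : ∀ i, MeasurableSet (A i)), (∀ i, A i ⊆ A (i + 1)) →
    IsLUB (Set.range fun i => toFun (A i) (hA i)) (toFun (⋃ i, A i) (MeasurableSet.iUnion hA))

/-! A monotone system is a chain, so its members are pairwise compatible and lie in a block. Blocks
are closed under defined sums, differences and countable joins and meets, and have the Riesz
decomposition property. So the observable can be built inside a block M and transferred back
(`exists_observable`).

Elements of M are then turned into random variables with values in [0,1]. Formal sums, compared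
through common refinements (`Sim`), behave like the positive cone of a lattice-ordered group. A
nonzero p forces X ≤ Y if this holds modulo something disjoint from p. Along a decreasing sequence
of nonzero elements, the value of a is the supremum of the fractions m/n for which some term forces
m·1 ≤ n·a. Meeting countably many dense sets makes such a sequence as generic as needed.
Generically, values are additive (`RieszDecomposition.eventually_value_add`), continuous along
monotone sequences (`RieszDecomposition.eventually_tendsto_of_isLUB`), and they determine the order
(`RieszDecomposition.le_of_eventually`).

Hence the values of a system satisfying (2)–(4) generically form the distribution function of a
probability measure. The Borel sets whose measure is generically the value of some element form a
Dynkin system containing the half-lines, so every Borel set has such an element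
(`RieszDecomposition.exists_represents`); it is unique and defines the observable. Uniqueness of the
observable is a second π-λ argument (`Observable.ext_of_Iic`). -/

namespace EffectAlgebra

/-! ### Totalized addition, cancellation and orthosupplements -/

/-- The total commutative monoid obtained from an effect algebra by adding an absorbing element
that stands for undefined sums. -/
def Tot (E : Type*) := Option E

/-- The inclusion of an effect algebra into its totalization. -/
def of {E : Type*} (a : E) : Tot E := some a

section Basic

variable {E : Type*} [EffectAlgebra E]

instance : Zero (Tot E) := ⟨of 0⟩

instance : Add (Tot E) := ⟨fun x y => Option.bind x fun a => Option.bind y fun b => padd a b⟩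

theorem Tot.zero_add (x : Tot E) : 0 + x = x := by
  rcases x with _ | a
  · rfl
  exact (padd_comm _ _).trans (padd_zero a)

theorem Tot.add_comm (x y : Tot E) : x + y = y + x := by
  rcases x with _ | a <;> rcases y with _ | b
  · rfl
  · rfl
  · rfl
  exact padd_comm a b

instance : AddCommMonoid (Tot E) where
  add_assoc x y z := by
    rcases x with _ | a
    · rfl
    rcases y with _ | b
    · rfl
    rcases z with _ | c
    · change (Option.bind (padd a b) fun _ => none) = none
      cases padd a b <;> rfl
    exact padd_assoc a b c
  zero_add := Tot.zero_add
  add_zero x := (Tot.add_comm _ _).trans (Tot.zero_add x)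
  add_comm := Tot.add_comm
  nsmul := nsmulRec

theorem of_injective {E : Type*} : Function.Injective (of : E → Tot E) := fun _ _ h => Option.some.inj h

@[simp] theorem of_inj {E : Type*} {a b : E} : of a = of b ↔ a = b := of_injective.eq_iff

@[simp] theorem of_zero : of (0 : E) = 0 := rfl

theorem of_add_of {a b c : E} : of a + of b = of c ↔ padd a b = some c := Iff.rfl

/-- The undefined value is absorbing, so a defined total makes every subterm defined. This is how
existence of partial sums is read off from identities proved by `abel`. -/
theorem exists_of_add_eq {x y : Tot E} {c : E} (h : x + y = of c) :
    ∃ a b, x = of a ∧ y = of b := by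
  rcases x with _ | a
  · exact absurd h (by rintro ⟨⟩)
  rcases y with _ | b
  · exact absurd h (by rintro ⟨⟩)
  exact ⟨a, b, rfl, rfl⟩

theorem exists_left_of_add {x y : Tot E} {c : E} (h : x + y = of c) : ∃ a, x = of a :=
  let ⟨a, _, h, _⟩ := exists_of_add_eq h
  ⟨a, h⟩

theorem exists_right_of_add {x y : Tot E} {c : E} (h : x + y = of c) : ∃ a, y = of a :=
  let ⟨_, b, _, h⟩ := exists_of_add_eq h
  ⟨b, h⟩

theorem le_def {a b : E} : a ≤ b ↔ ∃ c, of a + of c = of b := Iff.rfl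

theorem le_of_add {a b : E} {x : Tot E} (h : of a + x = of b) : a ≤ b := by
  obtain ⟨c, rfl⟩ := exists_right_of_add h
  exact ⟨c, h⟩

theorem exists_compl (a : E) : ∃ b, of a + of b = of 1 := (existsUnique_compl a).exists

theorem compl_unique {a b c : E} (hb : of a + of b = of 1) (hc : of a + of c = of 1) : b = c :=
  (existsUnique_compl a).unique hb hc

/-- After adding the supplement of c, both terms become the orthosupplement of the same element,
which is unique. -/
theorem add_left_cancel_of {a c : E} {x y : Tot E} (hx : of a + x = of c) (hy : of a + y = of c) :
    x = y := by
  obtain ⟨b, rfl⟩ := exists_right_of_add hx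
  obtain ⟨b', rfl⟩ := exists_right_of_add hy
  obtain ⟨c', hc⟩ := exists_compl c
  have h1 : of a + of c' + of b = of 1 := by rw [← hc, ← hx]; abel
  have h2 : of a + of c' + of b' = of 1 := by rw [← hc, ← hy]; abel
  obtain ⟨d, hd⟩ := exists_left_of_add h1
  rw [hd] at h1 h2
  rw [compl_unique h1 h2]

theorem add_cancel_of {x y z : Tot E} {c : E} (hx : z + x = of c) (hy : z + y = of c) : x = y := by
  obtain ⟨a, rfl⟩ := exists_left_of_add hx
  exact add_left_cancel_of hx hy

protected theorem zero_le (a : E) : 0 ≤ a := ⟨a, by rw [padd_comm, padd_zero]⟩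

protected theorem le_one (a : E) : a ≤ 1 := exists_compl a

theorem eq_zero_of_le_zero {a : E} (h : a ≤ 0) : a = 0 := le_antisymm h (EffectAlgebra.zero_le a)

theorem le_of_add_le_add {a b b' c c' : E} (h : of a + of b = of c) (h' : of a + of b' = of c')
    (hc : c ≤ c') : b ≤ b' := by
  obtain ⟨e, he⟩ := le_def.1 hc
  refine le_of_add (x := of e) (add_left_cancel_of (a := a) (c := c') ?_ h')
  rw [← add_assoc, h, he]

theorem exists_add_of_le {a b c d : E} (h : of b + of c = of d) (hab : a ≤ b) :
    ∃ e, of a + of c = of e ∧ e ≤ d := by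
  obtain ⟨k, hk⟩ := le_def.1 hab
  have h1 : of a + of c + of k = of d := by rw [← h, ← hk]; abel
  obtain ⟨e, he⟩ := exists_left_of_add h1
  exact ⟨e, he, le_of_add (he ▸ h1)⟩

/-- Subtraction reverses the order. -/
theorem le_of_add_eq_add {a b p q d : E} (h : of a + of p = of d) (h' : of b + of q = of d)
    (hab : a ≤ b) : q ≤ p := by
  obtain ⟨e, he⟩ := le_def.1 hab
  refine le_of_add (x := of e) (add_left_cancel_of (a := a) (c := d) ?_ h)
  rw [← h', ← he]; abel

/-- The orthosupplement. -/
noncomputable def compl (a : E) : E := (exists_compl a).choose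

theorem add_compl (a : E) : of a + of (compl a) = of 1 := (exists_compl a).choose_spec

theorem compl_compl (a : E) : compl (compl a) = a :=
  compl_unique (add_compl _) (by rw [add_comm, add_compl])

theorem compl_zero : compl (0 : E) = 1 := compl_unique (add_compl 0) (by simp)

theorem compl_anti {a b : E} (h : a ≤ b) : compl b ≤ compl a :=
  le_of_add_eq_add (add_compl a) (add_compl b) h

theorem le_compl_iff {a b : E} : a ≤ compl b ↔ ∃ c, of a + of b = of c := by
  constructor
  · intro h
    have := add_compl b
    rw [add_comm] at this
    obtain ⟨e, he, -⟩ := exists_add_of_le this h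
    exact ⟨e, he⟩
  · rintro ⟨c, hc⟩
    refine le_of_add (x := of (compl c)) (add_left_cancel_of (a := b) (c := 1) ?_ (add_compl b))
    rw [← add_compl c, ← hc]; abel

theorem le_compl_comm {a b : E} : a ≤ compl b ↔ b ≤ compl a := by
  rw [le_compl_iff, le_compl_iff, add_comm]

theorem eq_zero_of_add_self {a : E} {x : Tot E} (h : of a + x = of a) : x = 0 :=
  add_left_cancel_of h (add_zero _)

theorem isGLB_compl {s : Set E} {a : E} (h : IsLUB s a) : IsGLB (compl '' s) (compl a) := by
  constructor
  · rintro _ ⟨b, hb, rfl⟩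
    exact compl_anti (h.1 hb)
  · intro c hc
    rw [le_compl_comm]
    refine h.2 fun b hb => ?_
    rw [le_compl_comm]
    exact hc ⟨b, hb, rfl⟩

theorem isLUB_compl {s : Set E} {a : E} (h : IsGLB s a) : IsLUB (compl '' s) (compl a) := by
  constructor
  · rintro _ ⟨b, hb, rfl⟩
    exact compl_anti (h.1 hb)
  · intro c hc
    rw [← compl_compl c]
    refine compl_anti (h.2 fun b hb => ?_)
    rw [← compl_compl b]
    exact compl_anti (hc ⟨b, hb, rfl⟩)

/-! ### Meets and compatibility -/

/-- In presence of a meet, the remainders are disjoint. -/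
theorem eq_zero_of_isGLB {a b m p q k : E} (hm : IsGLB {a, b} m) (ha : of m + of p = of a)
    (hb : of m + of q = of b) (hp : k ≤ p) (hq : k ≤ q) : k = 0 := by
  rw [add_comm] at ha hb
  obtain ⟨e, he, hea⟩ := exists_add_of_le ha hp
  obtain ⟨e', he', heb⟩ := exists_add_of_le hb hq
  obtain rfl : e = e' := of_injective (he.symm.trans he')
  have hem : e ≤ m := hm.2 (by rintro x (rfl | rfl) <;> assumption)
  obtain ⟨z, hz⟩ := le_def.1 hem
  -- The element m + k is a lower bound of a and b, hence lies below m; cancelling m gives k + z =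
  -- 0.
  have h : of m + (of k + of z) = of m := by nth_rw 2 [← hz]; rw [← he]; abel
  have h0 : of k + of z = of 0 := eq_zero_of_add_self h
  exact eq_zero_of_le_zero (le_of_add h0)

/-- Compatibility of two elements of an effect algebra. -/
def Compat (a b : E) : Prop :=
  ∃ m p q d : E, of m + of p = of a ∧ of m + of q = of b ∧ of m + of p + of q = of d

theorem Compat.symm {a b : E} (h : Compat a b) : Compat b a := by
  obtain ⟨m, p, q, d, h1, h2, h3⟩ := h
  exact ⟨m, q, p, d, h2, h1, by rw [← h3]; abel⟩

theorem Compat.of_le {a b : E} (h : a ≤ b) : Compat a b := by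
  obtain ⟨c, hc⟩ := h
  exact ⟨a, 0, c, b, by simp, of_add_of.2 hc, by simpa using of_add_of.2 hc⟩
theorem Compat.refl (a : E) : Compat a a := Compat.of_le le_rfl

/-- Write 1 = m + p + q + r. Then b' = p + r, so p is a common part of a and b', with remainders m
and r. -/
theorem Compat.compl_right {a b : E} (h : Compat a b) : Compat a (compl b) := by
  obtain ⟨m, p, q, d, h1, h2, h3⟩ := h
  obtain ⟨r, hr⟩ := exists_compl d
  have hb : of p + of r = of (compl b) := by
    refine add_left_cancel_of (a := b) (c := 1) ?_ (add_compl b)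
    rw [← hr, ← h3, ← h2]; abel
  have h4 : of p + of m + of r + of q = of 1 := by rw [← hr, ← h3]; abel
  obtain ⟨e, he⟩ := exists_left_of_add h4
  exact ⟨p, m, r, e, by rw [← h1]; abel, hb, he⟩

/-- If `a` and `b` are compatible, then the remainder of `a` above the meet can be added to `b`. -/
theorem Compat.exists_add {a b m p : E} (h : Compat a b) (hm : IsGLB {a, b} m)
    (hp : of m + of p = of a) : ∃ d, of p + of b = of d := by
  obtain ⟨m₀, p₀, q₀, d, h1, h2, h3⟩ := h
  have hmm : m₀ ≤ m := hm.2 (by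
    rintro x (rfl | rfl)
    exacts [le_of_add h1, le_of_add h2])
  have hpp : p ≤ p₀ := le_of_add_eq_add h1 hp hmm
  have h4 : of p₀ + of b = of d := by rw [← h3, ← h2]; abel
  obtain ⟨e, he, -⟩ := exists_add_of_le h4 hpp
  exact ⟨e, he⟩

theorem compat_of_add {a b m p d : E} (hmb : m ≤ b) (hp : of m + of p = of a)
    (hd : of p + of b = of d) : Compat a b := by
  obtain ⟨q, hq⟩ := le_def.1 hmb
  exact ⟨m, p, q, d, hp, hq, by rw [← hd, ← hq]; abel⟩

/-- If `a` and `b` are compatible, then the remainder of `a` above the meet and `b` add up to the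
join. -/
theorem Compat.add_eq_of_isLUB {a b m p j : E} (h : Compat a b) (hm : IsGLB {a, b} m)
    (hj : IsLUB {a, b} j) (hp : of m + of p = of a) : of p + of b = of j := by
  obtain ⟨d, hd⟩ := h.exists_add hm hp
  obtain ⟨q, hq⟩ := le_def.1 (hm.1 (Set.mem_insert_of_mem a rfl))
  have had : of a + of q = of d := by rw [← hd, ← hp, ← hq]; abel
  have hbd : of b + of p = of d := by rw [← hd]; abel
  have hjd : j ≤ d := hj.2 (by
    rintro x (rfl | rfl)
    exacts [le_of_add had, le_of_add hbd])
  -- The excess of p + b over the join lies below both remainders, and these are disjoint.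
  obtain ⟨k, hk⟩ := le_def.1 hjd
  have hkq : k ≤ q := le_of_add_eq_add had hk (hj.1 (Set.mem_insert a {b}))
  have hkp : k ≤ p := le_of_add_eq_add hbd hk (hj.1 (Set.mem_insert_of_mem a rfl))
  obtain rfl := eq_zero_of_isGLB hm hp hq hkp hkq
  rw [hd, ← hk]; simp

end Basic

/-! ### Compatibility under countable joins, differences and sums -/

section Lattice

variable {E : Type*} [EffectAlgebra E] [IsSigmaLatticeEffectAlgebra E]

theorem exists_isGLB_pair (a b : E) : ∃ m, IsGLB {a, b} m := by
  obtain ⟨m, hm⟩ := IsSigmaLatticeEffectAlgebra.exists_isGLB fun n : ℕ => if n = 0 then a else b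
  refine ⟨m, ?_⟩
  convert hm using 1
  ext x
  constructor
  · rintro (rfl | rfl)
    exacts [⟨0, rfl⟩, ⟨1, rfl⟩]
  · rintro ⟨n, rfl⟩
    by_cases h : n = 0 <;> simp [h]

theorem exists_isLUB_pair (a b : E) : ∃ m, IsLUB {a, b} m := by
  obtain ⟨m, hm⟩ := IsSigmaLatticeEffectAlgebra.exists_isLUB fun n : ℕ => if n = 0 then a else b
  refine ⟨m, ?_⟩
  convert hm using 1
  ext x
  constructor
  · rintro (rfl | rfl)
    exacts [⟨0, rfl⟩, ⟨1, rfl⟩]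
  · rintro ⟨n, rfl⟩
    by_cases h : n = 0 <;> simp [h]

theorem exists_meet_decomposition (a b : E) :
    ∃ m p q, IsGLB {a, b} m ∧ of m + of p = of a ∧ of m + of q = of b := by
  obtain ⟨m, hm⟩ := exists_isGLB_pair a b
  obtain ⟨p, hp⟩ := hm.1 (Set.mem_insert a {b})
  obtain ⟨q, hq⟩ := hm.1 (Set.mem_insert_of_mem a rfl)
  exact ⟨m, p, q, hm, hp, hq⟩

/-- Let p be the remainder of c above c ∧ s. It lies below the remainder of c above c ∧ y i, which
can be added to y i. So every y i, and hence s, lies below the supplement of p. -/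
theorem Compat.of_isLUB {c s : E} {y : ℕ → E} (h : ∀ i, Compat c (y i))
    (hs : IsLUB (Set.range y) s) : Compat c s := by
  obtain ⟨m, p, q, hm, hp, hq⟩ := exists_meet_decomposition c s
  have hle : s ≤ compl p := by
    refine hs.2 ?_
    rintro _ ⟨i, rfl⟩
    obtain ⟨m', p', q', hm', hp', hq'⟩ := exists_meet_decomposition c (y i)
    obtain ⟨d, hd⟩ := (h i).exists_add hm' hp'
    have hmm : m' ≤ m := hm.2 (by
      rintro x (rfl | rfl)
      · exact le_of_add hp'
      · exact (le_of_add hq').trans (hs.1 ⟨i, rfl⟩))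
    obtain ⟨e, he, -⟩ := exists_add_of_le hd (le_of_add_eq_add hp' hp hmm)
    exact le_compl_iff.2 ⟨e, by rw [← he]; abel⟩
  obtain ⟨d, hd⟩ := le_compl_iff.1 hle
  exact compat_of_add (le_of_add hq) hp (d := d) (by rw [← hd]; abel)

/-- Split m and a along their meets with c. Both the meets and the remainders increase from m to a,
so p = e + t with e the difference of the meets and t that of the remainders. Then e ≤ c, while t +
c is defined because it is a part of a ∨ c. -/
theorem Compat.of_add_eq {a c m p : E} (hp : of m + of p = of a) (hm : Compat m c)
    (ha : Compat a c) : Compat p c := by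
  obtain ⟨mc, m₁, g₁, hmc, hm₁, hg₁⟩ := exists_meet_decomposition m c
  obtain ⟨ac, a₁, g₂, hac, ha₁, hg₂⟩ := exists_meet_decomposition a c
  obtain ⟨jm, hjm⟩ := exists_isLUB_pair m c
  obtain ⟨ja, hja⟩ := exists_isLUB_pair a c
  have e1 := hm.add_eq_of_isLUB hmc hjm hm₁
  have e2 := ha.add_eq_of_isLUB hac hja ha₁
  have hma : m ≤ a := le_of_add hp
  have hj : jm ≤ ja := hjm.2 (by
    rintro x (rfl | rfl)
    · exact hma.trans (hja.1 (Set.mem_insert _ _))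
    · exact hja.1 (Set.mem_insert_of_mem _ rfl))
  have hmac : mc ≤ ac := hac.2 (by
    rintro x (rfl | rfl)
    · exact (le_of_add hm₁).trans hma
    · exact le_of_add hg₁)
  have h1 : m₁ ≤ a₁ := by
    rw [add_comm] at e1 e2
    exact le_of_add_le_add e1 e2 hj
  obtain ⟨t, ht⟩ := le_def.1 h1
  obtain ⟨e, he⟩ := le_def.1 hmac
  have hpe : of e + of t = of p := by
    refine add_left_cancel_of (a := m) (c := a) ?_ hp
    rw [← hm₁, ← ha₁, ← he, ← ht]; abel
  have h3 : of m₁ + (of t + of c) = of ja := by rw [← e2, ← ht]; abel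
  obtain ⟨d, hd⟩ := exists_right_of_add h3
  have hec : e ≤ c := by
    refine le_trans (le_of_add (x := of mc) ?_) (le_of_add hg₂)
    rw [← he]; abel
  exact compat_of_add hec hpe hd

/-- Sums reduce to differences by passing to supplements: d' is b' minus a. -/
theorem Compat.add {a b c d : E} (hd : of a + of b = of d) (ha : Compat a c) (hb : Compat b c) :
    Compat d c := by
  have h1 : of a + of (compl d) = of (compl b) := by
    refine add_left_cancel_of (a := b) (c := 1) ?_ (add_compl b)
    rw [← add_compl d, ← hd]; abel
  have h2 := Compat.of_add_eq h1 ha hb.symm.compl_right.symm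
  simpa [compl_compl] using h2.symm.compl_right.symm

end Lattice
-- Blocks as σ-lattice effect algebras with Riesz decomposition
section Block

variable {E : Type*} [EffectAlgebra E]

/-- A block: a maximal set of pairwise compatible elements. -/
def IsBlock (M : Set E) : Prop := ∀ a, a ∈ M ↔ ∀ b ∈ M, Compat a b

theorem exists_isBlock {s : Set E} (hs : ∀ a ∈ s, ∀ b ∈ s, Compat a b) :
    ∃ M, IsBlock M ∧ s ⊆ M := by
  -- Since `Compat` is symmetric, a chain for it is a set of pairwise compatible elements, so Zorn's
  -- lemma for chains applies.
  obtain ⟨M, hM, hsM⟩ := IsChain.exists_maxChain (r := Compat) (c := s)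
    (fun a ha b hb _ => Or.inl (hs a ha b hb))
  have hc : ∀ a ∈ M, ∀ b ∈ M, Compat a b := by
    intro a ha b hb
    by_cases hab : a = b
    · rw [hab]; exact Compat.refl b
    · exact (hM.1 ha hb hab).elim id Compat.symm
  refine ⟨M, fun a => ⟨fun ha b hb => hc a ha b hb, fun h => ?_⟩, hsM⟩
  have h1 : IsChain Compat (insert a M) := hM.1.insert fun b hb _ => Or.inl (h b hb)
  rw [hM.2 h1 (Set.subset_insert a M)]
  exact Set.mem_insert a M

/-- The type of elements of a set, without the order of the subtype. -/
@[ext]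
structure Block (M : Set E) where
  val : E
  mem : val ∈ M

variable {M : Set E}

theorem IsBlock.compat (hM : IsBlock M) {a b : E} (ha : a ∈ M) (hb : b ∈ M) : Compat a b :=
  (hM a).1 ha b hb

theorem IsBlock.zero_mem (hM : IsBlock M) : (0 : E) ∈ M :=
  (hM 0).2 fun b _ => Compat.of_le (EffectAlgebra.zero_le b)

theorem IsBlock.one_mem (hM : IsBlock M) : (1 : E) ∈ M :=
  (hM 1).2 fun b _ => (Compat.of_le (EffectAlgebra.le_one b)).symm

theorem IsBlock.compl_mem (hM : IsBlock M) {a : E} (ha : a ∈ M) : compl a ∈ M :=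
  (hM _).2 fun _ hb => (hM.compat hb ha).compl_right.symm

theorem IsBlock.of_add_mem [IsSigmaLatticeEffectAlgebra E] (hM : IsBlock M) {a b c : E}
    (h : of a + of b = of c) (ha : a ∈ M) (hc : c ∈ M) : b ∈ M :=
  (hM _).2 fun _ hd => Compat.of_add_eq h (hM.compat ha hd) (hM.compat hc hd)

theorem IsBlock.add_mem [IsSigmaLatticeEffectAlgebra E] (hM : IsBlock M) {a b c : E}
    (h : of a + of b = of c) (ha : a ∈ M) (hb : b ∈ M) : c ∈ M :=
  (hM _).2 fun _ hd => Compat.add h (hM.compat ha hd) (hM.compat hb hd)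

theorem IsBlock.isLUB_mem [IsSigmaLatticeEffectAlgebra E] (hM : IsBlock M) {y : ℕ → E} {s : E}
    (hy : ∀ i, y i ∈ M) (hs : IsLUB (Set.range y) s) : s ∈ M :=
  (hM _).2 fun _ hd => (Compat.of_isLUB (fun i => hM.compat hd (hy i)) hs).symm

theorem IsBlock.isGLB_mem [IsSigmaLatticeEffectAlgebra E] (hM : IsBlock M) {y : ℕ → E} {s : E}
    (hy : ∀ i, y i ∈ M) (hs : IsGLB (Set.range y) s) : s ∈ M := by
  have h := isLUB_compl hs
  rw [← Set.range_comp] at h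
  have h1 := hM.compl_mem (hM.isLUB_mem (fun i => hM.compl_mem (hy i)) h)
  rwa [compl_compl] at h1

open Classical in
/-- The partial addition of a set of elements of an effect algebra. -/
noncomputable def Block.padd (a b : Block M) : Option (Block M) :=
  if h : ∃ c : Block M, EffectAlgebra.padd a.val b.val = some c.val then some h.choose else none

theorem Block.padd_eq_some {a b c : Block M} :
    Block.padd a b = some c ↔ EffectAlgebra.padd a.val b.val = some c.val := by
  unfold Block.padd
  split_ifs with h
  · have h1 := h.choose_spec
    generalize h.choose = e at h1
    rw [h1, Option.some_inj, Option.some_inj, Block.ext_iff]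
  · simp only [false_iff]
    exact fun h1 => h ⟨c, h1⟩

/-- A block is an effect algebra. -/
@[reducible]
noncomputable def blockEffectAlgebra [IsSigmaLatticeEffectAlgebra E] (hM : IsBlock M) :
    EffectAlgebra (Block M) where
  zero := ⟨0, hM.zero_mem⟩
  one := ⟨1, hM.one_mem⟩
  padd := Block.padd
  padd_comm a b := by
    ext c
    rw [Block.padd_eq_some, Block.padd_eq_some, padd_comm]
  padd_assoc a b c := by
    -- Intermediate sums stay in M, so a triple sum in the block is the triple sum in E, and
    -- associativity is inherited from `Tot E`.
    have key : ∀ a b c e : Block M, ((Block.padd a b).bind fun d => Block.padd d c) = some e ↔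
        of a.val + of b.val + of c.val = of e.val := by
      intro a b c e
      rw [Option.bind_eq_some_iff]
      constructor
      · rintro ⟨d, h1, h2⟩
        rw [Block.padd_eq_some] at h1 h2
        rw [of_add_of.2 h1]
        exact h2
      · intro h
        obtain ⟨d, hd⟩ := exists_left_of_add h
        refine ⟨⟨d, hM.add_mem hd a.mem b.mem⟩, Block.padd_eq_some.2 hd, Block.padd_eq_some.2 ?_⟩
        rw [hd] at h
        exact h
    have comm : ∀ a b : Block M, Block.padd a b = Block.padd b a := by
      intro a b
      ext c
      rw [Block.padd_eq_some, Block.padd_eq_some, padd_comm]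
    ext e
    have h1 := key b c a e
    simp only [comm _ a] at h1
    rw [key, h1]
    constructor <;> intro h <;> rw [← h] <;> abel
  existsUnique_compl a := by
    refine ⟨⟨compl a.val, hM.compl_mem a.mem⟩, Block.padd_eq_some.2 (add_compl a.val), ?_⟩
    intro b hb
    exact Block.ext (compl_unique (Block.padd_eq_some.1 hb) (add_compl a.val))
  eq_zero_of_padd_one a h := by
    obtain ⟨c, hc⟩ := Option.isSome_iff_exists.1 h
    rw [Block.padd_eq_some] at hc
    refine Block.ext (eq_zero_of_padd_one a.val ?_)
    have : EffectAlgebra.padd a.val 1 = some c.val := hc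
    rw [this]; rfl

/-- The Riesz decomposition property of an effect algebra. -/
def RieszDecomposition (M : Type*) [EffectAlgebra M] : Prop :=
  ∀ a b c d : M, of b + of c = of d → a ≤ d → ∃ a₁ a₂, a₁ ≤ b ∧ a₂ ≤ c ∧ of a₁ + of a₂ = of a

section

variable [IsSigmaLatticeEffectAlgebra E] (hM : IsBlock M)

theorem block_add_iff {a b c : Block M} : letI := blockEffectAlgebra hM
    of a + of b = of c ↔ of a.val + of b.val = of c.val :=
  Block.padd_eq_some

theorem block_le_iff {a b : Block M} : letI := blockEffectAlgebra hM
    a ≤ b ↔ a.val ≤ b.val := by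
  let _ := blockEffectAlgebra hM
  constructor
  · rintro ⟨c, hc⟩
    exact ⟨c.val, Block.padd_eq_some.1 hc⟩
  · rintro ⟨c, hc⟩
    exact ⟨⟨c, hM.of_add_mem (of_add_of.2 hc) a.mem b.mem⟩, Block.padd_eq_some.2 hc⟩

theorem block_isLUB {ι : Type*} {y : ι → Block M} {s : Block M}
    (h : IsLUB (Set.range fun i => (y i).val) s.val) : letI := blockEffectAlgebra hM
    IsLUB (Set.range y) s := by
  let _ := blockEffectAlgebra hM
  constructor
  · rintro _ ⟨i, rfl⟩
    exact (block_le_iff hM).2 (h.1 ⟨i, rfl⟩)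
  · intro c hc
    refine (block_le_iff hM).2 (h.2 ?_)
    rintro _ ⟨i, rfl⟩
    exact (block_le_iff hM).1 (hc ⟨i, rfl⟩)

theorem block_isGLB {ι : Type*} {y : ι → Block M} {s : Block M}
    (h : IsGLB (Set.range fun i => (y i).val) s.val) : letI := blockEffectAlgebra hM
    IsGLB (Set.range y) s := by
  let _ := blockEffectAlgebra hM
  constructor
  · rintro _ ⟨i, rfl⟩
    exact (block_le_iff hM).2 (h.1 ⟨i, rfl⟩)
  · intro c hc
    refine (block_le_iff hM).2 (h.2 ?_)
    rintro _ ⟨i, rfl⟩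
    exact (block_le_iff hM).1 (hc ⟨i, rfl⟩)

/-- The joins of sequences in a block agree with the joins in the effect algebra. -/
theorem isLUB_of_block {y : ℕ → Block M} {s : Block M} :
    letI := blockEffectAlgebra hM
    IsLUB (Set.range y) s → IsLUB (Set.range fun i => (y i).val) s.val := by
  let _ := blockEffectAlgebra hM
  intro h
  obtain ⟨t, ht⟩ := IsSigmaLatticeEffectAlgebra.exists_isLUB fun i => (y i).val
  have h1 := block_isLUB hM (s := ⟨t, hM.isLUB_mem (fun i => (y i).mem) ht⟩) ht
  rw [h.unique h1]
  exact ht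

theorem block_isSigmaLattice : letI := blockEffectAlgebra hM
    IsSigmaLatticeEffectAlgebra (Block M) := by
  let _ := blockEffectAlgebra hM
  constructor
  · intro y
    obtain ⟨t, ht⟩ := IsSigmaLatticeEffectAlgebra.exists_isLUB fun i => (y i).val
    exact ⟨_, block_isLUB hM (s := ⟨t, hM.isLUB_mem (fun i => (y i).mem) ht⟩) ht⟩
  · intro y
    obtain ⟨t, ht⟩ := IsSigmaLatticeEffectAlgebra.exists_isGLB fun i => (y i).val
    exact ⟨_, block_isGLB hM (s := ⟨t, hM.isGLB_mem (fun i => (y i).mem) ht⟩) ht⟩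

/-- Take a ∧ b and the remainder p of a above it. By compatibility p + b = a ∨ b, which is below b +
c; cancelling b gives p ≤ c. -/
theorem block_rieszDecomposition : letI := blockEffectAlgebra hM
    RieszDecomposition (Block M) := by
  let _ := blockEffectAlgebra hM
  have _ := block_isSigmaLattice hM
  intro a b c d hd had
  obtain ⟨m, p, q, hm, hp, hq⟩ := exists_meet_decomposition a b
  refine ⟨m, p, le_of_add hq, ?_, hp⟩
  -- The meet in E belongs to the block, so it coincides with the meet in the block.
  have hm' : IsGLB {a.val, b.val} m.val := by
    obtain ⟨n, hn⟩ := IsSigmaLatticeEffectAlgebra.exists_isGLB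
      fun i : ℕ => if i = 0 then a.val else b.val
    have hr : (Set.range fun i : ℕ => if i = 0 then a.val else b.val) = {a.val, b.val} := by
      ext x
      constructor
      · rintro ⟨i, rfl⟩
        by_cases h : i = 0 <;> simp [h]
      · rintro (rfl | rfl)
        exacts [⟨0, rfl⟩, ⟨1, rfl⟩]
    have hnM : n ∈ M := hM.isGLB_mem (fun i => by split_ifs; exacts [a.mem, b.mem]) hn
    rw [hr] at hn
    have h1 : n ≤ m.val := (block_le_iff hM (a := ⟨n, hnM⟩)).1 (hm.2 (by
      rintro x (rfl | rfl)
      · exact (block_le_iff hM).2 (hn.1 (Set.mem_insert _ _))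
      · exact (block_le_iff hM).2 (hn.1 (Set.mem_insert_of_mem _ rfl))))
    have h2 : m.val ≤ n := hn.2 (by
      rintro x (rfl | rfl)
      · exact (block_le_iff hM).1 (hm.1 (Set.mem_insert _ _))
      · exact (block_le_iff hM).1 (hm.1 (Set.mem_insert_of_mem _ rfl)))
    rwa [le_antisymm h2 h1]
  obtain ⟨j, hj⟩ := exists_isLUB_pair a.val b.val
  have e1 := (hM.compat a.mem b.mem).add_eq_of_isLUB hm' hj ((block_add_iff hM).1 hp)
  have hd' := (block_add_iff hM).1 hd
  have hjd : j ≤ d.val := hj.2 (by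
    rintro x (rfl | rfl)
    · exact (block_le_iff hM).1 had
    · exact le_of_add hd')
  rw [add_comm] at e1
  exact (block_le_iff hM).2 (le_of_add_le_add e1 hd' hjd)

end

end Block

/-! ### Formal sums up to common refinement -/

section Formal

variable {M : Type*} [EffectAlgebra M]

/-- The sum of the family `V` is defined and equal to `x`. -/
def Split (x : M) (V : Multiset M) : Prop := (V.map of).sum = of x

/-- `W` arises from the formal sum `X` by splitting every summand. -/
def Refines (X W : Multiset M) : Prop := ∃ V, Multiset.Rel Split X V ∧ V.join = W

theorem Refines.zero : Refines (0 : Multiset M) 0 := ⟨0, Multiset.Rel.zero, rfl⟩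

theorem Refines.add {X Y V W : Multiset M} (h : Refines X V) (h' : Refines Y W) :
    Refines (X + Y) (V + W) := by
  obtain ⟨S, hS, rfl⟩ := h
  obtain ⟨T, hT, rfl⟩ := h'
  exact ⟨S + T, hS.add hT, Multiset.join_add _ _⟩

theorem Split.refines {x : M} {V : Multiset M} (h : Split x V) : Refines {x} V :=
  ⟨{V}, Multiset.Rel.cons h Multiset.Rel.zero, by simp⟩

theorem refines_zero_left {W : Multiset M} (h : Refines 0 W) : W = 0 := by
  obtain ⟨S, hS, rfl⟩ := h
  rw [Multiset.rel_zero_left] at hS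
  simp [hS]

theorem refines_singleton {x : M} {W : Multiset M} (h : Refines {x} W) : Split x W := by
  obtain ⟨S, hS, rfl⟩ := h
  rw [← Multiset.cons_zero, Multiset.rel_cons_left] at hS
  obtain ⟨b, bs, hb, hbs, rfl⟩ := hS
  rw [Multiset.rel_zero_left] at hbs
  simpa [hbs] using hb

theorem refines_add_left {X Y W : Multiset M} (h : Refines (X + Y) W) :
    ∃ W₁ W₂, Refines X W₁ ∧ Refines Y W₂ ∧ W = W₁ + W₂ := by
  obtain ⟨S, hS, rfl⟩ := h
  rw [Multiset.rel_add_left] at hS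
  obtain ⟨S₁, S₂, h₁, h₂, rfl⟩ := hS
  exact ⟨_, _, ⟨S₁, h₁, rfl⟩, ⟨S₂, h₂, rfl⟩, Multiset.join_add _ _⟩

theorem refines_cons_left {x : M} {X W : Multiset M} (h : Refines (x ::ₘ X) W) :
    ∃ V W', Split x V ∧ Refines X W' ∧ W = V + W' := by
  rw [← Multiset.singleton_add] at h
  obtain ⟨V, W', h₁, h₂, rfl⟩ := refines_add_left h
  exact ⟨V, W', refines_singleton h₁, h₂, rfl⟩

theorem Split.refines_cons {x : M} {V X W : Multiset M} (h : Split x V) (h' : Refines X W) :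
    Refines (x ::ₘ X) (V + W) := by
  rw [← Multiset.singleton_add]
  exact h.refines.add h'

theorem split_singleton (x : M) : Split x {x} := by simp [Split]

theorem split_pair {a b c : M} (h : of a + of b = of c) : Split c {a, b} := by simpa [Split] using h

theorem Refines.refl (X : Multiset M) : Refines X X := by
  induction X using Multiset.induction with
  | empty => exact Refines.zero
  | cons a X ih => simpa using (split_singleton a).refines_cons ih

theorem Refines.sum_eq {X W : Multiset M} (h : Refines X W) :
    (W.map of).sum = (X.map of).sum := by
  induction X using Multiset.induction generalizing W with
  | empty => rw [refines_zero_left h]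
  | cons a X ih =>
    obtain ⟨V, W', h₁, h₂, rfl⟩ := refines_cons_left h
    rw [Multiset.map_add, Multiset.sum_add, ih h₂, Multiset.map_cons, Multiset.sum_cons, h₁]

theorem Refines.trans {X Y Z : Multiset M} (h : Refines X Y) (h' : Refines Y Z) :
    Refines X Z := by
  induction X using Multiset.induction generalizing Y Z with
  | empty => rw [refines_zero_left h] at h'; exact h'
  | cons a X ih =>
    obtain ⟨V, W', h₁, h₂, rfl⟩ := refines_cons_left h
    obtain ⟨Z₁, Z₂, h₃, h₄, rfl⟩ := refines_add_left h'
    exact Split.refines_cons (h₃.sum_eq.trans h₁) (ih h₂ h₄)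

/-- Cuts V along a decomposition a + t of its total: Riesz decomposition splits a between the first
summand and the rest, and the rest is cut recursively. A collects the pieces of a, B those of t. -/
theorem RieszDecomposition.exists_refines (hR : RieszDecomposition M) {V : Multiset M} {a d : M}
    {t : Tot M} (hV : (V.map of).sum = of d) (hd : of a + t = of d) :
    ∃ A B, Refines V (A + B) ∧ (A.map of).sum = of a ∧ (B.map of).sum = t := by
  induction V using Multiset.induction generalizing a d t with
  | empty =>
    obtain rfl : 0 = d := of_injective hV
    obtain rfl := eq_zero_of_le_zero (le_of_add hd)
    refine ⟨0, 0, Refines.zero, rfl, ?_⟩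
    simpa using hd.symm
  | cons b V ih =>
    rw [Multiset.map_cons, Multiset.sum_cons] at hV
    obtain ⟨s, hs⟩ := exists_right_of_add hV
    rw [hs] at hV
    obtain ⟨a₁, a₂, h₁, h₂, h₃⟩ := hR a b s d hV (le_of_add hd)
    obtain ⟨b₂, hb₂⟩ := le_def.1 h₁
    obtain ⟨s₂, hs₂⟩ := le_def.1 h₂
    obtain ⟨A, B, hAB, hA, hB⟩ := ih hs hs₂
    refine ⟨a₁ ::ₘ A, b₂ ::ₘ B, ?_, ?_, ?_⟩
    · have h := (split_pair hb₂).refines_cons hAB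
      convert h using 1
      simp only [← Multiset.singleton_add, Multiset.insert_eq_cons]
      abel
    · rw [Multiset.map_cons, Multiset.sum_cons, hA, h₃]
    · rw [Multiset.map_cons, Multiset.sum_cons, hB]
      refine add_left_cancel_of (a := a) (c := d) ?_ hd
      rw [← hV, ← h₃, ← hb₂, ← hs₂]; abel

/-- The empty multiset is a splitting of 0, so refining may delete zero summands. -/
theorem refines_zero_of_forall {B : Multiset M} (h : ∀ b ∈ B, b = 0) : Refines B 0 := by
  induction B using Multiset.induction with
  | empty => exact Refines.zero
  | cons b B ih =>
    obtain rfl := h b (Multiset.mem_cons_self b B)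
    have h0 : Split (0 : M) 0 := by simp [Split]
    exact h0.refines_cons (ih fun b hb => h b (Multiset.mem_cons_of_mem hb))

theorem refines_zero_of_split {B : Multiset M} (h : Split 0 B) : Refines B 0 := by
  refine refines_zero_of_forall fun b hb => ?_
  obtain ⟨B, rfl⟩ := Multiset.exists_cons_of_mem hb
  unfold Split at h
  rw [Multiset.map_cons, Multiset.sum_cons] at h
  exact eq_zero_of_le_zero (le_of_add h)

theorem RieszDecomposition.exists_common (hR : RieszDecomposition M) {A B : Multiset M} {d : M}
    (hA : Split d A) (hB : Split d B) : ∃ C, Refines A C ∧ Refines B C := by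
  induction A using Multiset.induction generalizing B d with
  | empty =>
    obtain rfl : 0 = d := of_injective hA
    exact ⟨0, Refines.zero, refines_zero_of_split hB⟩
  | cons a A ih =>
    unfold Split at hA
    rw [Multiset.map_cons, Multiset.sum_cons] at hA
    obtain ⟨B₁, B₂, h, h₁, h₂⟩ := hR.exists_refines hB hA
    obtain ⟨t, ht⟩ := exists_right_of_add hA
    obtain ⟨C, hC₁, hC₂⟩ := ih ht (h₂.trans ht)
    exact ⟨B₁ + C, Split.refines_cons h₁ hC₁, h.trans ((Refines.refl B₁).add hC₂)⟩

/-- Equality of formal sums: existence of a common refinement. -/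
def Sim (X Y : Multiset M) : Prop := ∃ W, Refines X W ∧ Refines Y W

theorem Refines.sim {X Y : Multiset M} (h : Refines X Y) : Sim X Y := ⟨Y, h, Refines.refl Y⟩

theorem Sim.refl (X : Multiset M) : Sim X X := (Refines.refl X).sim

theorem Sim.symm {X Y : Multiset M} (h : Sim X Y) : Sim Y X :=
  let ⟨W, h₁, h₂⟩ := h
  ⟨W, h₂, h₁⟩

theorem Sim.add {X Y X' Y' : Multiset M} (h : Sim X Y) (h' : Sim X' Y') :
    Sim (X + X') (Y + Y') :=
  let ⟨_, h₁, h₂⟩ := h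
  let ⟨_, h₃, h₄⟩ := h'
  ⟨_, h₁.add h₃, h₂.add h₄⟩

theorem Sim.sum_eq {X Y : Multiset M} (h : Sim X Y) : (X.map of).sum = (Y.map of).sum :=
  let ⟨_, h₁, h₂⟩ := h
  h₁.sum_eq.symm.trans h₂.sum_eq

theorem RieszDecomposition.common (hR : RieszDecomposition M) {Y V W : Multiset M}
    (hV : Refines Y V) (hW : Refines Y W) : ∃ C, Refines V C ∧ Refines W C := by
  induction Y using Multiset.induction generalizing V W with
  | empty =>
    rw [refines_zero_left hV, refines_zero_left hW]
    exact ⟨0, Refines.zero, Refines.zero⟩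
  | cons y Y ih =>
    obtain ⟨A, V, hA, hV', rfl⟩ := refines_cons_left hV
    obtain ⟨B, W, hB, hW', rfl⟩ := refines_cons_left hW
    obtain ⟨C, hC₁, hC₂⟩ := hR.exists_common hA hB
    obtain ⟨D, hD₁, hD₂⟩ := ih hV' hW'
    exact ⟨C + D, hC₁.add hD₁, hC₂.add hD₂⟩

/-- Two refinements of Y have a common refinement because, by Riesz decomposition, any two
splittings of one element do. -/
theorem RieszDecomposition.sim_trans (hR : RieszDecomposition M) {X Y Z : Multiset M}
    (h : Sim X Y) (h' : Sim Y Z) : Sim X Z := by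
  obtain ⟨V, h₁, h₂⟩ := h
  obtain ⟨W, h₃, h₄⟩ := h'
  obtain ⟨C, h₅, h₆⟩ := hR.common h₂ h₃
  exact ⟨C, h₁.trans h₅, h₄.trans h₆⟩

theorem _root_.Multiset.exists_of_add_eq_add {α : Type*} {A B C D : Multiset α}
    (h : A + B = C + D) :
    ∃ AC AD BC BD, A = AC + AD ∧ B = BC + BD ∧ C = AC + BC ∧ D = AD + BD := by
  classical
  refine ⟨A ∩ C, A - C, C - A, B - (C - A), ?_, ?_, ?_, ?_⟩ <;>
  · ext x
    have h := congrArg (Multiset.count x) h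
    simp only [Multiset.count_add, Multiset.count_sub, Multiset.count_inter] at h ⊢
    omega

/-- Cancel one summand z at a time. A common refinement contains two splittings of z; outside their
overlap `zz`, the pieces `Az` and `zB` have the same sum. A common refinement of these two repairs
the match between X and Y. -/
theorem RieszDecomposition.sim_cancel (hR : RieszDecomposition M) {X Y Z : Multiset M}
    (h : Sim (X + Z) (Y + Z)) : Sim X Y := by
  induction Z using Multiset.induction generalizing X Y with
  | empty => simpa using h
  | cons z Z ih =>
    refine ih ?_
    have e : ∀ X : Multiset M, X + z ::ₘ Z = X + Z + {z} := by
      intro X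
      rw [← Multiset.singleton_add]; abel
    rw [e, e] at h
    generalize X + Z = X at h ⊢
    generalize Y + Z = Y at h ⊢
    obtain ⟨W, h₁, h₂⟩ := h
    obtain ⟨A, V, hA, hV, rfl⟩ := refines_add_left h₁
    obtain ⟨B, V', hB, hV', he⟩ := refines_add_left h₂
    obtain ⟨AB, Az, zB, zz, rfl, rfl, rfl, rfl⟩ := Multiset.exists_of_add_eq_add he
    have hV := refines_singleton hV
    have hV' := refines_singleton hV'
    unfold Split at hV hV'
    rw [Multiset.map_add, Multiset.sum_add] at hV hV'
    obtain ⟨s, hs⟩ := exists_left_of_add hV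
    have hs' := add_cancel_of ((add_comm _ _).trans hV) ((add_comm _ _).trans hV')
    obtain ⟨C, hC₁, hC₂⟩ := hR.exists_common (A := Az) (hs'.symm.trans hs) hs
    exact ⟨AB + C, hA.trans ((Refines.refl _).add hC₁), hB.trans ((Refines.refl _).add hC₂)⟩

/-! ### Order, disjointness and meets of formal sums -/

/-- The order of formal sums. -/
def Dom (X Y : Multiset M) : Prop := ∃ H, Sim (X + H) Y

theorem Sim.dom {X Y : Multiset M} (h : Sim X Y) : Dom X Y := ⟨0, by simpa using h⟩

theorem Dom.refl (X : Multiset M) : Dom X X := (Sim.refl X).dom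

theorem dom_add_right (X Y : Multiset M) : Dom X (X + Y) := ⟨Y, Sim.refl _⟩

theorem dom_add_left (X Y : Multiset M) : Dom X (Y + X) := ⟨Y, by rw [add_comm]; exact Sim.refl _⟩

theorem Dom.add {X Y X' Y' : Multiset M} (h : Dom X Y) (h' : Dom X' Y') :
    Dom (X + X') (Y + Y') := by
  obtain ⟨H, h⟩ := h
  obtain ⟨H', h'⟩ := h'
  refine ⟨H + H', ?_⟩
  have := h.add h'
  rwa [add_add_add_comm]

theorem RieszDecomposition.dom_trans (hR : RieszDecomposition M) {X Y Z : Multiset M}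
    (h : Dom X Y) (h' : Dom Y Z) : Dom X Z := by
  obtain ⟨H, h⟩ := h
  obtain ⟨H', h'⟩ := h'
  refine ⟨H + H', hR.sim_trans ?_ h'⟩
  rw [← add_assoc]
  exact h.add (Sim.refl H')

theorem RieszDecomposition.dom_cancel (hR : RieszDecomposition M) {X Y Z : Multiset M}
    (h : Dom (X + Z) (Y + Z)) : Dom X Y := by
  obtain ⟨H, h⟩ := h
  rw [add_right_comm] at h
  exact ⟨H, hR.sim_cancel h⟩

theorem Dom.exists_sum {X : Multiset M} {c : M} (h : Dom X {c}) :
    ∃ d, (X.map of).sum = of d ∧ d ≤ c := by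
  obtain ⟨H, h⟩ := h
  have h := h.sum_eq
  rw [Multiset.map_add, Multiset.sum_add, Multiset.map_singleton, Multiset.sum_singleton] at h
  obtain ⟨d, hd⟩ := exists_left_of_add h
  exact ⟨d, hd, le_of_add (hd ▸ h)⟩

theorem dom_singleton {a b : M} : Dom {a} {b} ↔ a ≤ b := by
  constructor
  · intro h
    obtain ⟨d, hd, hdb⟩ := h.exists_sum
    rw [Multiset.map_singleton, Multiset.sum_singleton, of_inj] at hd
    rwa [hd]
  · rintro ⟨c, hc⟩
    exact ⟨{c}, (split_pair hc).refines.sim.symm⟩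

theorem eq_zero_of_dom_zero {q : M} (h : Dom {q} 0) : q = 0 := by
  obtain ⟨H, h⟩ := h
  have h := h.sum_eq
  simp only [Multiset.map_add, Multiset.sum_add, Multiset.map_singleton, Multiset.sum_singleton,
    Multiset.map_zero, Multiset.sum_zero] at h
  exact eq_zero_of_le_zero (le_of_add h)

/-- A common refinement of p + H and X + Y sorts the pieces of p into those from X and those from Y.
-/
theorem dom_add_decompose {p : M} {X Y : Multiset M} (h : Dom {p} (X + Y)) :
    ∃ q r, of q + of r = of p ∧ Dom {q} X ∧ Dom {r} Y := by
  obtain ⟨H, W, h₁, h₂⟩ := h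
  obtain ⟨V, V', hV, hV', rfl⟩ := refines_add_left h₁
  obtain ⟨A, B, hA, hB, he⟩ := refines_add_left h₂
  obtain ⟨VA, VB, A', B', rfl, rfl, rfl, rfl⟩ := Multiset.exists_of_add_eq_add he
  have hV := refines_singleton hV
  unfold Split at hV
  rw [Multiset.map_add, Multiset.sum_add] at hV
  obtain ⟨q, r, hq, hr⟩ := exists_of_add_eq hV
  rw [hq, hr] at hV
  exact ⟨q, r, hV, ⟨A', _, (Split.refines hq).add (Refines.refl _), hA⟩,
    ⟨B', _, (Split.refines hr).add (Refines.refl _), hB⟩⟩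

/-- Two formal sums without a common nonzero lower bound in the effect algebra. -/
def Orth (X Y : Multiset M) : Prop := ∀ q, Dom {q} X → Dom {q} Y → q = 0

theorem Orth.symm {X Y : Multiset M} (h : Orth X Y) : Orth Y X := fun q h₁ h₂ => h q h₂ h₁

theorem RieszDecomposition.orth_mono (hR : RieszDecomposition M) {X Y Z : Multiset M}
    (h : Orth Y Z) (hXY : Dom X Y) : Orth X Z := fun q h₁ h₂ => h q (hR.dom_trans h₁ hXY) h₂

theorem RieszDecomposition.orth_add (hR : RieszDecomposition M) {X Y Z : Multiset M}
    (h : Orth X Y) (h' : Orth X Z) : Orth X (Y + Z) := by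
  intro p h₁ h₂
  obtain ⟨q, r, hp, hq, hr⟩ := dom_add_decompose h₂
  have hq0 := h q (hR.dom_trans (dom_singleton.2 (le_of_add hp)) h₁) hq
  have hr0 := h' r (hR.dom_trans (dom_singleton.2 (le_of_add ((add_comm _ _).trans hp))) h₁) hr
  subst hq0 hr0
  exact of_injective (hp.symm.trans (by simp))

theorem orth_zero (X : Multiset M) : Orth X 0 := fun _ _ h => eq_zero_of_dom_zero h

theorem RieszDecomposition.orth_nsmul (hR : RieszDecomposition M) {X Y : Multiset M}
    (h : Orth X Y) (n : ℕ) : Orth X (n • Y) := by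
  induction n with
  | zero => rw [zero_smul]; exact orth_zero X
  | succ n ih => rw [succ_nsmul]; exact hR.orth_add ih h

section Lattice

variable [IsSigmaLatticeEffectAlgebra M]

/-- Remove a ∧ y, then compare what is left of a with the remaining summands. Shrinking a further
keeps it disjoint from the remainder of y. -/
theorem RieszDecomposition.exists_orth_singleton (hR : RieszDecomposition M) (a : M)
    (Y : Multiset M) : ∃ Z a₀ Y₀, Sim {a} (Z + {a₀}) ∧ Sim Y (Z + Y₀) ∧ Orth {a₀} Y₀ := by
  induction Y using Multiset.induction generalizing a with
  | empty => exact ⟨0, a, 0, by simpa using Sim.refl _, by simpa using Sim.refl _, orth_zero _⟩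
  | cons y Y ih =>
    obtain ⟨m, a₀, y₀, hm, ha₀, hy₀⟩ := exists_meet_decomposition a y
    obtain ⟨Z, a₁, Y₀, h₁, h₂, h₃⟩ := ih a₀
    refine ⟨{m} + Z, a₁, {y₀} + Y₀, ?_, ?_, ?_⟩
    · rw [add_assoc]
      exact hR.sim_trans (split_pair ha₀).refines.sim ((Sim.refl {m}).add h₁)
    · have h := ((split_pair hy₀).refines.sim).add h₂
      rw [Multiset.singleton_add] at h
      convert h using 1
      rw [Multiset.insert_eq_cons, ← Multiset.singleton_add]
      abel
    · refine hR.orth_add (hR.orth_mono (Y := {a₀}) ?_ ?_) h₃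
      · intro q hq hq'
        exact eq_zero_of_isGLB hm ha₀ hy₀ (dom_singleton.1 hq) (dom_singleton.1 hq')
      · exact hR.dom_trans (dom_add_left _ _) h₁.symm.dom

theorem RieszDecomposition.exists_orth (hR : RieszDecomposition M) (X Y : Multiset M) :
    ∃ Z X₀ Y₀, Sim X (Z + X₀) ∧ Sim Y (Z + Y₀) ∧ Orth X₀ Y₀ := by
  induction X using Multiset.induction generalizing Y with
  | empty =>
    exact ⟨0, 0, Y, by simpa using Sim.refl _, by simpa using Sim.refl _, (orth_zero _).symm⟩
  | cons x X ih =>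
    obtain ⟨Z, x₁, Y₁, h₁, h₂, h₃⟩ := hR.exists_orth_singleton x Y
    obtain ⟨Z', X₀, Y₀, h₄, h₅, h₆⟩ := ih Y₁
    refine ⟨Z + Z', {x₁} + X₀, Y₀, ?_, ?_, ?_⟩
    · rw [← Multiset.singleton_add, add_add_add_comm]
      exact h₁.add h₄
    · rw [add_assoc]
      exact hR.sim_trans h₂ ((Sim.refl Z).add h₅)
    · refine (hR.orth_add (hR.orth_mono h₃.symm ?_) h₆.symm).symm
      exact hR.dom_trans (dom_add_left _ _) h₅.symm.dom

end Lattice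

end Formal
-- Forcing inequalities between formal sums
section Forcing

variable {M : Type*} [EffectAlgebra M]

/-- The element `p` forces `X ≤ Y`: the inequality holds up to a formal sum disjoint from `p`. -/
def Forces (p : M) (X Y : Multiset M) : Prop := ∃ H, Orth {p} H ∧ Dom X (Y + H)

theorem Dom.forces {X Y : Multiset M} (h : Dom X Y) (p : M) : Forces p X Y :=
  ⟨0, orth_zero _, by simpa using h⟩

theorem Dom.nsmul {X Y : Multiset M} (h : Dom X Y) (n : ℕ) : Dom (n • X) (n • Y) := by
  induction n with
  | zero => simpa using Dom.refl 0
  | succ n ih => rw [succ_nsmul, succ_nsmul]; exact ih.add h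

theorem dom_nsmul_one (n : ℕ) (a : M) : Dom (n • {a}) (n • {1}) :=
  (dom_singleton.2 (EffectAlgebra.le_one a)).nsmul n

theorem forces_add_of_orth {p : M} {X Y : Multiset M} (h : Orth {p} Y) : Forces p (X + Y) X :=
  ⟨Y, h, Dom.refl _⟩

variable (hR : RieszDecomposition M)

include hR

theorem RieszDecomposition.forces_mono {p q : M} {X Y : Multiset M} (h : Forces p X Y)
    (hqp : q ≤ p) : Forces q X Y := by
  obtain ⟨H, h₁, h₂⟩ := h
  exact ⟨H, hR.orth_mono h₁ (dom_singleton.2 hqp), h₂⟩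

theorem RieszDecomposition.forces_trans {p : M} {X Y Z : Multiset M} (h : Forces p X Y)
    (h' : Forces p Y Z) : Forces p X Z := by
  obtain ⟨H, h₁, h₂⟩ := h
  obtain ⟨H', h₃, h₄⟩ := h'
  refine ⟨H' + H, hR.orth_add h₃ h₁, hR.dom_trans h₂ ?_⟩
  rw [← add_assoc]
  exact h₄.add (Dom.refl H)

theorem RieszDecomposition.forces_add {p : M} {X Y X' Y' : Multiset M} (h : Forces p X Y)
    (h' : Forces p X' Y') : Forces p (X + X') (Y + Y') := by
  obtain ⟨H, h₁, h₂⟩ := h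
  obtain ⟨H', h₃, h₄⟩ := h'
  refine ⟨H + H', hR.orth_add h₁ h₃, ?_⟩
  rw [add_add_add_comm]
  exact h₂.add h₄

theorem RieszDecomposition.forces_nsmul {p : M} {X Y : Multiset M} (h : Forces p X Y) (n : ℕ) :
    Forces p (n • X) (n • Y) := by
  induction n with
  | zero => simpa using (Dom.refl 0).forces p
  | succ n ih => rw [succ_nsmul, succ_nsmul]; exact hR.forces_add ih h

theorem RieszDecomposition.forces_cancel {p : M} {X Y Z : Multiset M}
    (h : Forces p (X + Z) (Y + Z)) : Forces p X Y := by
  obtain ⟨H, h₁, h₂⟩ := h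
  rw [add_right_comm] at h₂
  exact ⟨H, h₁, hR.dom_cancel h₂⟩

theorem RieszDecomposition.eq_zero_of_forces {p : M} (h : Forces p {1} 0) : p = 0 := by
  obtain ⟨H, h₁, h₂⟩ := h
  rw [zero_add] at h₂
  exact h₁ p (Dom.refl _) (hR.dom_trans (dom_singleton.2 (EffectAlgebra.le_one p)) h₂)

/-- Otherwise cancelling l copies of 1 would make p force 1 ≤ 0, hence p = 0. -/
theorem RieszDecomposition.le_of_forces_nsmul {p : M} (hp : p ≠ 0) {k l : ℕ}
    (h : Forces p (k • {1}) (l • {1})) : k ≤ l := by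
  by_contra! hlt
  obtain ⟨j, rfl⟩ := Nat.exists_eq_add_of_lt hlt
  have h1 : Forces p ({1} + j • {1} + l • {1}) (0 + l • {1}) := by
    convert h using 1
    · rw [add_nsmul, add_nsmul, one_nsmul]; abel
    · rw [zero_add]
  exact hp (hR.eq_zero_of_forces
    (hR.forces_trans ((dom_add_right _ _).forces p) (hR.forces_cancel h1)))

theorem RieszDecomposition.mul_le_mul_of_forces {p a : M} (hp : p ≠ 0) {m n m' n' : ℕ}
    (h : Forces p (m • {1}) (n • {a})) (h' : Forces p (n' • {a}) (m' • {1})) :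
    n' * m ≤ n * m' := by
  refine hR.le_of_forces_nsmul hp ?_
  have h1 := hR.forces_nsmul h n'
  have h2 := hR.forces_nsmul h' n
  simp only [smul_smul] at h1 h2
  rw [mul_comm n' n] at h1
  exact hR.forces_trans h1 h2

/-- Remove a common part so that the remainders X₀ and Y₀ are disjoint. Either p is disjoint from
X₀, or some nonzero q ≤ p lies below X₀ and is therefore disjoint from Y₀. -/
theorem RieszDecomposition.forces_or [IsSigmaLatticeEffectAlgebra M] (p : M) (X Y : Multiset M) :
    Forces p X Y ∨ ∃ q ≤ p, q ≠ 0 ∧ Forces q Y X := by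
  obtain ⟨Z, X₀, Y₀, h₁, h₂, h₃⟩ := hR.exists_orth X Y
  have key : ∀ {X Y X₀ Y₀ : Multiset M} (p : M), Sim X (Z + X₀) → Sim Y (Z + Y₀) →
      Orth {p} X₀ → Forces p X Y := fun p h h' ho =>
    ⟨_, ho, hR.dom_trans h.dom (hR.dom_trans ((dom_add_right Z _).add (Dom.refl _))
      (h'.symm.dom.add (Dom.refl _)))⟩
  by_cases ho : Orth {p} X₀
  · exact Or.inl (key p h₁ h₂ ho)
  · unfold Orth at ho
    push Not at ho
    obtain ⟨q, hqp, hq, hq0⟩ := ho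
    exact Or.inr ⟨q, dom_singleton.1 hqp, hq0, key q h₂ h₁ (hR.orth_mono h₃ hq)⟩

end Forcing

/-! ### Generic paths and real values -/

section Generic

open Filter

variable {M : Type*} [EffectAlgebra M]

/-- Decreasing sequences of nonzero elements. -/
def Path (M : Type*) [EffectAlgebra M] := {w : ℕ → M // Antitone w ∧ ∀ i, w i ≠ 0}

/-- Every nonzero element has a nonzero element of `D` below it. -/
def DenseBelow (D : Set M) : Prop := ∀ p : M, p ≠ 0 → ∃ q ≤ p, q ≠ 0 ∧ q ∈ D

/-- The filter of generic paths. -/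
def generic (M : Type*) [EffectAlgebra M] : Filter (Path M) :=
  countableGenerate {s | ∃ D : Set M, DenseBelow D ∧ s = {w | ∃ i, w.1 i ∈ D}}

instance : CountableInterFilter (generic M) := by unfold generic; infer_instance

theorem eventually_generic {D : Set M} (hD : DenseBelow D) : ∀ᶠ w in generic M, ∃ i, w.1 i ∈ D :=
  CountableGenerateSets.basic ⟨D, hD, rfl⟩

/-- The Rasiowa–Sikorski argument: an eventual property depends on countably many dense sets, which
are met one per step starting from p. -/
theorem exists_path_of_eventually {φ : Path M → Prop} (h : ∀ᶠ w in generic M, φ w) {p : M}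
    (hp : p ≠ 0) : ∃ w, φ w ∧ w.1 0 = p := by
  obtain ⟨S, hSg, hS, hSφ⟩ := mem_countableGenerate_iff.1 h
  -- Adding `Set.univ` makes the family nonempty, so that a sequence can enumerate it.
  obtain ⟨f, hf⟩ := (hS.insert Set.univ).exists_eq_range (Set.insert_nonempty _ _)
  have hD : ∀ n, ∃ D : Set M, DenseBelow D ∧ {w : Path M | ∃ i, w.1 i ∈ D} ⊆ f n := by
    intro n
    have hn : f n ∈ insert Set.univ S := hf ▸ ⟨n, rfl⟩
    rcases hn with hn | hn
    · exact ⟨Set.univ, fun p hp => ⟨p, le_rfl, hp, trivial⟩, hn ▸ Set.subset_univ _⟩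
    · obtain ⟨D, hD, he⟩ := hSg hn
      exact ⟨D, hD, he.ge⟩
  choose D hD hDf using hD
  choose g hg using fun (n : ℕ) (q : {q : M // q ≠ 0}) => hD n q.1 q.2
  let u : ℕ → {q : M // q ≠ 0} := Nat.rec ⟨p, hp⟩ fun n q => ⟨g n q, (hg n q).2.1⟩
  let w : Path M := ⟨fun n => (u n).1, antitone_nat_of_succ_le fun n => (hg n (u n)).1,
    fun n => (u n).2⟩
  refine ⟨w, hSφ fun s hs => ?_, rfl⟩
  obtain ⟨n, rfl⟩ : s ∈ Set.range f := hf ▸ Set.mem_insert_of_mem _ hs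
  exact hDf n ⟨n + 1, (hg n (u n)).2.2⟩

/-- The set of fractions `m / n` that the path `w` forces to be below `a`. -/
def lowerCut (w : Path M) (a : M) : Set ℝ :=
  {r | ∃ m n i : ℕ, 0 < n ∧ Forces (w.1 i) (m • {1}) (n • {a}) ∧ r = m / n}

/-- The value of `a` along a path. -/
noncomputable def value (w : Path M) (a : M) : ℝ := sSup (lowerCut w a)

theorem zero_mem_lowerCut (w : Path M) (a : M) : 0 ∈ lowerCut w a :=
  ⟨0, 1, 0, one_pos, Dom.forces (by simpa using dom_add_right 0 _) _, by simp⟩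

section

variable (hR : RieszDecomposition M)

include hR

theorem RieszDecomposition.mem_upperBounds {w : Path M} {a : M} {m n i : ℕ} (hn : 0 < n)
    (h : Forces (w.1 i) (n • {a}) (m • {1})) : (m / n : ℝ) ∈ upperBounds (lowerCut w a) := by
  rintro _ ⟨m', n', j, hn', h', rfl⟩
  have h1 := hR.mul_le_mul_of_forces (w.2.2 (max i j))
    (hR.forces_mono h' (w.2.1 (le_max_right i j))) (hR.forces_mono h (w.2.1 (le_max_left i j)))
  rw [div_le_div_iff₀ (by positivity) (by positivity)]
  have h2 : (n * m' : ℝ) ≤ n' * m := by exact_mod_cast h1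
  linarith

theorem RieszDecomposition.one_mem_upperBounds (w : Path M) (a : M) :
    (1 : ℝ) ∈ upperBounds (lowerCut w a) := by
  simpa using hR.mem_upperBounds (w := w) (a := a) (i := 0) one_pos ((dom_nsmul_one 1 a).forces _)

theorem RieszDecomposition.le_value {w : Path M} {a : M} {m n i : ℕ} (hn : 0 < n)
    (h : Forces (w.1 i) (m • {1}) (n • {a})) : (m / n : ℝ) ≤ value w a :=
  le_csSup ⟨1, hR.one_mem_upperBounds w a⟩ ⟨m, n, i, hn, h, rfl⟩

theorem RieszDecomposition.value_le {w : Path M} {a : M} {m n i : ℕ} (hn : 0 < n)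
    (h : Forces (w.1 i) (n • {a}) (m • {1})) : value w a ≤ m / n :=
  csSup_le ⟨0, zero_mem_lowerCut w a⟩ (hR.mem_upperBounds hn h)

theorem RieszDecomposition.value_nonneg (w : Path M) (a : M) : 0 ≤ value w a :=
  le_csSup ⟨1, hR.one_mem_upperBounds w a⟩ (zero_mem_lowerCut w a)

theorem RieszDecomposition.value_le_one (w : Path M) (a : M) : value w a ≤ 1 :=
  csSup_le ⟨0, zero_mem_lowerCut w a⟩ (hR.one_mem_upperBounds w a)

theorem RieszDecomposition.value_one (w : Path M) : value w (1 : M) = 1 := by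
  refine le_antisymm (hR.value_le_one w 1) ?_
  simpa using hR.le_value (w := w) (a := 1) (m := 1) (i := 0) one_pos ((Dom.refl _).forces _)

theorem RieszDecomposition.value_zero (w : Path M) : value w (0 : M) = 0 := by
  refine le_antisymm ?_ (hR.value_nonneg w 0)
  have h : Dom ({0} : Multiset M) 0 := (refines_zero_of_forall (by simp)).sim.dom
  simpa using hR.value_le (w := w) (a := 0) (m := 0) (n := 1) (i := 0) one_pos
    (Dom.forces (by simpa using h) _)

section

variable [IsSigmaLatticeEffectAlgebra M]

theorem RieszDecomposition.eventually_forces (X Y : Multiset M) :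
    ∀ᶠ w in generic M, ∃ i, Forces (w.1 i) X Y ∨ Forces (w.1 i) Y X := by
  refine eventually_generic (D := {p | Forces p X Y ∨ Forces p Y X}) fun p hp => ?_
  rcases hR.forces_or p X Y with h | ⟨q, hq, hq0, h⟩
  exacts [⟨p, le_rfl, hp, Or.inl h⟩, ⟨q, hq, hq0, Or.inr h⟩]

/-- Take the last m for which m·1 ≤ n·a is forced. It exists since n·a ≤ n·1, and generic
comparability forces the reverse inequality at m + 1. This locates the value of a within 1/n. -/
theorem RieszDecomposition.eventually_approx (a : M) :
    ∀ᶠ w in generic M, ∀ n : ℕ, ∃ m i : ℕ, Forces (w.1 i) (m • {1}) (n • {a}) ∧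
      Forces (w.1 i) (n • {a}) ((m + 1) • {1}) := by
  have h : ∀ᶠ w in generic M, ∀ n m : ℕ, ∃ i,
      Forces (w.1 i) (m • {1}) (n • {a}) ∨ Forces (w.1 i) (n • {a}) (m • {1}) := by
    simp only [eventually_countable_forall]
    exact fun n m => hR.eventually_forces _ _
  filter_upwards [h] with w hw n
  obtain ⟨m, ⟨i, hi⟩, hm⟩ : ∃ m : ℕ, (∃ i, Forces (w.1 i) (m • {1}) (n • {a})) ∧
      ¬ ∃ i, Forces (w.1 i) ((m + 1) • {1}) (n • {a}) := by
    by_contra! hcon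
    have hall : ∀ m : ℕ, ∃ i, Forces (w.1 i) (m • {1}) (n • {a}) := by
      intro m
      induction m with
      | zero => exact ⟨0, Dom.forces (by simpa using dom_add_right 0 _) _⟩
      | succ m ih => exact hcon m ih
    obtain ⟨i, hi⟩ := hall (n + 1)
    have := hR.le_of_forces_nsmul (w.2.2 i) (hR.forces_trans hi ((dom_nsmul_one n a).forces _))
    omega
  obtain ⟨j, hj⟩ := hw n (m + 1)
  have hj' : Forces (w.1 j) (n • {a}) ((m + 1) • {1}) :=
    hj.resolve_left fun h => hm ⟨j, h⟩
  exact ⟨m, max i j, hR.forces_mono hi (w.2.1 (le_max_left i j)),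
    hR.forces_mono hj' (w.2.1 (le_max_right i j))⟩

/-- Values are generically additive. -/
theorem RieszDecomposition.eventually_value_add {a b c : M} (h : of a + of b = of c) :
    ∀ᶠ w in generic M, value w a + value w b = value w c := by
  filter_upwards [hR.eventually_approx a, hR.eventually_approx b] with w ha hb
  have hs : ∀ n : ℕ, n • ({a} : Multiset M) + n • {b} = n • {a, b} := by
    intro n
    rw [← nsmul_add]; rfl
  have hsim := (split_pair h).refines.sim
  -- Both quantities lie between (k + l)/n and (k + l + 2)/n.
  have key : ∀ n : ℕ, 0 < n → |value w a + value w b - value w c| ≤ 2 / n := by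
    intro n hn
    obtain ⟨k, i, h1, h2⟩ := ha n
    obtain ⟨l, j, h3, h4⟩ := hb n
    have hi := w.2.1 (le_max_left i j)
    have hj := w.2.1 (le_max_right i j)
    have h5 := hR.forces_trans (hR.forces_add (hR.forces_mono h1 hi) (hR.forces_mono h3 hj))
      (Z := n • {c}) (Dom.forces (by rw [hs]; exact hsim.symm.dom.nsmul n) _)
    have h6 := hR.forces_trans (X := n • {c})
      (Dom.forces (by rw [hs]; exact hsim.dom.nsmul n) _)
      (hR.forces_add (hR.forces_mono h2 hi) (hR.forces_mono h4 hj))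
    rw [← add_nsmul] at h5 h6
    have b1 := hR.le_value hn h1
    have b2 := hR.value_le hn h2
    have b3 := hR.le_value hn h3
    have b4 := hR.value_le hn h4
    have b5 := hR.le_value hn h5
    have b6 := hR.value_le hn h6
    have hn' : (0 : ℝ) < n := by exact_mod_cast hn
    push_cast at b1 b2 b3 b4 b5 b6
    rw [div_le_iff₀ hn'] at b1 b3 b5
    rw [le_div_iff₀ hn'] at b2 b4 b6 ⊢
    have habs := abs_mul (value w a + value w b - value w c) (n : ℝ)
    rw [abs_of_pos hn'] at habs
    rw [← habs, abs_le]
    constructor <;> linarith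
  have hlim : Tendsto (fun n : ℕ => (2 : ℝ) / n) atTop (nhds 0) :=
    tendsto_const_div_atTop_nhds_zero_nat 2
  have h0 : |value w a + value w b - value w c| ≤ 0 :=
    ge_of_tendsto hlim (eventually_atTop.2 ⟨1, fun n hn => key n hn⟩)
  have := abs_eq_zero.1 (le_antisymm h0 (abs_nonneg _))
  linarith

theorem RieszDecomposition.eventually_value_mono {a b : M} (h : a ≤ b) :
    ∀ᶠ w in generic M, value w a ≤ value w b := by
  obtain ⟨c, hc⟩ := le_def.1 h
  filter_upwards [hR.eventually_value_add hc] with w hw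
  have := hR.value_nonneg w c
  linarith

/-- To get p ≤ y k, let p₀ be the remainder of p above p ∧ y k. Splitting p below N·y n + y k puts
the second piece below the meet, so p₀ ≤ N·y n for all n, and induction on N gives p₀ = 0. -/
theorem RieszDecomposition.eq_zero_of_dom_nsmul {y : ℕ → M} (hy : Antitone y)
    (h0 : IsGLB (Set.range y) 0) (N : ℕ) {p : M} (hp : ∀ n, Dom {p} (N • {y n})) : p = 0 := by
  induction N generalizing p with
  | zero => exact eq_zero_of_dom_zero (by simpa using hp 0)
  | succ N ih =>
    refine eq_zero_of_le_zero (h0.2 ?_)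
    rintro _ ⟨k, rfl⟩
    obtain ⟨m, p₀, q, hm, hp₀, hq⟩ := exists_meet_decomposition p (y k)
    suffices hz : p₀ = 0 by
      subst hz
      have : m = p := by simpa using hp₀
      rw [← this]
      exact le_of_add hq
    refine ih fun n => ?_
    have h1 : Dom {p} (N • {y (max k n)} + {y (max k n)}) := by rw [← succ_nsmul]; exact hp _
    have h2 : Dom {p} (N • {y n} + {y k}) := hR.dom_trans h1
      (((dom_singleton.2 (hy (le_max_right k n))).nsmul N).add
        (dom_singleton.2 (hy (le_max_left k n))))
    obtain ⟨r, s, hrs, hr, hs⟩ := dom_add_decompose h2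
    rw [add_comm] at hrs
    have hsm : s ≤ m := hm.2 (by
      rintro x (rfl | rfl)
      exacts [le_of_add hrs, dom_singleton.1 hs])
    exact hR.dom_trans (dom_singleton.2 (le_of_add_eq_add hrs hp₀ hsm)) hr

/-- Values are generically continuous along decreasing sequences with meet zero. -/
theorem RieszDecomposition.eventually_exists_value_le {y : ℕ → M} (hy : Antitone y)
    (h0 : IsGLB (Set.range y) 0) :
    ∀ᶠ w in generic M, ∀ N : ℕ, 0 < N → ∃ n, value w (y n) ≤ 1 / N := by
  rw [eventually_countable_forall]
  intro N
  -- If nothing nonzero below p forces N·y n ≤ 1 for any n, then p forces 1 ≤ N·y n for every n.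
  -- Hence p ≤ N·y n for all n, and p = 0.
  have hD : DenseBelow {p : M | ∃ n, Forces p (N • {y n}) (1 • {1})} := by
    intro p hp
    by_contra! hcon
    refine hp (hR.eq_zero_of_dom_nsmul hy h0 N fun n => ?_)
    rcases hR.forces_or p (1 • {1}) (N • {y n}) with ⟨H, h1, h2⟩ | ⟨q, hq, hq0, h⟩
    · have h3 : Dom {p} (N • {y n} + H) := hR.dom_trans
        (by simpa using dom_singleton.2 (EffectAlgebra.le_one p)) h2
      obtain ⟨q, r, hqr, hq, hr⟩ := dom_add_decompose h3
      have hr0 : r = 0 := h1 r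
        (dom_singleton.2 (le_of_add ((add_comm _ _).trans hqr))) hr
      subst hr0
      have : q = p := by simpa using hqr
      rwa [← this]
    · exact absurd ⟨n, h⟩ (hcon q hq hq0)
  filter_upwards [eventually_generic hD] with w hw hN
  obtain ⟨i, n, h⟩ := hw
  exact ⟨n, by simpa using hR.value_le hN h⟩

omit hR in
/-- An effect algebra with joins of sequences is Archimedean. -/
theorem eq_zero_of_forall_dom {c : M} (h : ∀ n : ℕ, Dom (n • {c}) {1}) : c = 0 := by
  have hz : ∀ n : ℕ, ∃ z, n • of c = of z := by
    intro n
    obtain ⟨d, hd, -⟩ := (h n).exists_sum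
    exact ⟨d, by rw [← hd, Multiset.map_nsmul, Multiset.sum_nsmul, Multiset.map_singleton,
      Multiset.sum_singleton]⟩
  choose z hz using hz
  have hs : ∀ n, of c + of (z n) = of (z (n + 1)) := by
    intro n
    rw [← hz, ← hz, succ_nsmul, add_comm]
  obtain ⟨s, hs'⟩ := IsSigmaLatticeEffectAlgebra.exists_isLUB z
  have hcs : c ≤ s := (le_of_add (hs 0)).trans (hs'.1 ⟨1, rfl⟩)
  obtain ⟨t, ht⟩ := le_def.1 hcs
  have hst : s ≤ t := hs'.2 (by
    rintro _ ⟨n, rfl⟩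
    exact le_of_add_le_add (hs n) ht (hs'.1 ⟨n + 1, rfl⟩))
  obtain rfl : s = t := le_antisymm hst (le_of_add ((add_comm _ _).trans ht))
  rw [add_comm] at ht
  exact of_injective (eq_zero_of_add_self ht)

/-- Values determine the order. -/
theorem RieszDecomposition.le_of_eventually {a b : M}
    (h : ∀ᶠ w in generic M, value w a ≤ value w b) : a ≤ b := by
  obtain ⟨m, c, d, hm, hc, hd⟩ := exists_meet_decomposition a b
  suffices hc0 : c = 0 by
    subst hc0
    have : m = a := by simpa using hc
    rw [← this]
    exact le_of_add hd
  -- If n·c ≰ 1, some nonzero q lies below the excess of n·c over 1. It forces 1 ≤ n·c, and also d ≤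
  -- 0 because d is disjoint from n·c. On a generic path from q the value of a then exceeds that of
  -- b by at least 1/n.
  refine eq_zero_of_forall_dom fun n => ?_
  by_contra hn
  obtain ⟨Z, X₀, Y₀, h₁, h₂, h₃⟩ := hR.exists_orth (n • {c}) {1}
  obtain ⟨q, hq, hq0⟩ : ∃ q, Dom {q} X₀ ∧ q ≠ 0 := by
    by_contra! hcon
    refine hn (hR.dom_trans h₁.dom (hR.dom_trans ?_ h₂.symm.dom))
    refine (Dom.refl Z).add (hR.dom_trans (Y := 0) ?_ (by simpa using dom_add_right 0 Y₀))
    refine (refines_zero_of_forall fun x hx => hcon x ?_).sim.dom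
    obtain ⟨X, rfl⟩ := Multiset.exists_cons_of_mem hx
    rw [← Multiset.singleton_add]
    exact dom_add_right _ _
  have hqc : Dom {q} (n • {c}) :=
    hR.dom_trans hq (hR.dom_trans (dom_add_left _ _) h₁.symm.dom)
  have hf : Forces q (1 • {1}) (n • {c}) := by
    refine ⟨Y₀, hR.orth_mono h₃ hq, ?_⟩
    rw [one_nsmul]
    exact hR.dom_trans h₂.dom
      ((hR.dom_trans (dom_add_right _ _) h₁.symm.dom).add (Dom.refl Y₀))
  have hdc : Orth {d} (n • {c}) := hR.orth_nsmul (fun x hx hx' =>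
    eq_zero_of_isGLB hm hc hd (dom_singleton.1 hx') (dom_singleton.1 hx)) n
  have hd0 : Forces q (1 • {d}) (0 • {1}) := by
    have := forces_add_of_orth (X := 0) (hR.orth_mono hdc.symm hqc)
    simpa using this
  have hn0 : 0 < n := by
    rcases Nat.eq_zero_or_pos n with rfl | hn0
    · exact absurd (by simpa using dom_add_right 0 _) hn
    · exact hn0
  obtain ⟨w, ⟨hw, hwa, hwb⟩, rfl⟩ := exists_path_of_eventually
    (h.and ((hR.eventually_value_add hc).and (hR.eventually_value_add hd))) hq0
  have h4 := hR.le_value hn0 hf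
  have h5 := hR.value_le one_pos hd0
  have h6 : (0 : ℝ) < (1 : ℕ) / n := by positivity
  have h7 : ((0 : ℕ) : ℝ) / (1 : ℕ) = 0 := by simp
  linarith

end

end

end Generic

/-! ### Measures along generic paths and represented Borel sets -/

section Measures

open Filter MeasureTheory ProbabilityTheory Set Topology

/-- The element `a` represents the set `A` if the measures of `A` are generically the values
of `a`. -/
def Represents {M : Type*} [EffectAlgebra M] (μ : Path M → Measure ℝ) (A : Set ℝ) (a : M) : Prop :=
  ∀ᶠ w in generic M, (μ w).real A = value w a

variable {M : Type*} [EffectAlgebra M] [IsSigmaLatticeEffectAlgebra M]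
  (hR : RieszDecomposition M)

include hR

theorem RieszDecomposition.eventually_monotone {ι : Type*} [Preorder ι] [Countable ι] {a : ι → M}
    (ha : Monotone a) : ∀ᶠ w in generic M, Monotone fun n => value w (a n) := by
  have h : ∀ᶠ w in generic M, ∀ i j, i ≤ j → value w (a i) ≤ value w (a j) := by
    simp only [eventually_countable_forall]
    exact fun i j hij => hR.eventually_value_mono (ha hij)
  filter_upwards [h] with w hw i j hij using hw i j hij

/-- The differences s − a n decrease to 0, so by additivity this reduces to continuity at 0. -/
theorem RieszDecomposition.eventually_tendsto_of_isLUB {a : ℕ → M} {s : M} (ha : Monotone a)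
    (hs : IsLUB (range a) s) :
    ∀ᶠ w in generic M, Tendsto (fun n => value w (a n)) atTop (𝓝 (value w s)) := by
  choose y hy using fun n => le_def.1 (hs.1 ⟨n, rfl⟩ : a n ≤ s)
  have hanti : Antitone y := fun i j hij => le_of_add_eq_add (hy i) (hy j) (ha hij)
  have h0 : IsGLB (range y) 0 := by
    refine ⟨fun x _ => EffectAlgebra.zero_le x, fun z hz => ?_⟩
    have hzs : z ≤ s := (hz ⟨0, rfl⟩).trans (le_of_add ((add_comm _ _).trans (hy 0)))
    obtain ⟨t, ht⟩ := le_def.1 hzs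
    have hst : s ≤ t := hs.2 (by
      rintro _ ⟨n, rfl⟩
      exact le_of_add_eq_add ht ((add_comm _ _).trans (hy n)) (hz ⟨n, rfl⟩))
    obtain rfl : s = t := le_antisymm hst (le_of_add ((add_comm _ _).trans ht))
    rw [add_comm] at ht
    exact (of_injective (eq_zero_of_add_self ht)).le
  have hadd : ∀ᶠ w in generic M, ∀ n, value w (a n) + value w (y n) = value w s :=
    eventually_countable_forall.2 fun n => hR.eventually_value_add (hy n)
  filter_upwards [hadd, hR.eventually_monotone ha, hR.eventually_exists_value_le hanti h0]
    with w h1 h2 h3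
  rw [Metric.tendsto_atTop]
  intro ε hε
  obtain ⟨N, hN⟩ := exists_nat_one_div_lt hε
  obtain ⟨n, hn⟩ := h3 (N + 1) N.succ_pos
  refine ⟨n, fun k hk => ?_⟩
  have h4 := h2 hk
  have h5 := h1 n
  have h6 := h1 k
  have h7 := hR.value_nonneg w (y k)
  push_cast at hn
  rw [Real.dist_eq, abs_sub_lt_iff]
  simp only at h4
  constructor <;> linarith

theorem RieszDecomposition.eventually_value_compl (a : M) :
    ∀ᶠ w in generic M, value w (compl a) = 1 - value w a := by
  filter_upwards [hR.eventually_value_add (add_compl a)] with w hw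
  rw [hR.value_one] at hw
  linarith

theorem RieszDecomposition.eventually_tendsto_of_isGLB {a : ℕ → M} {s : M} (ha : Antitone a)
    (hs : IsGLB (range a) s) :
    ∀ᶠ w in generic M, Tendsto (fun n => value w (a n)) atTop (𝓝 (value w s)) := by
  have h := isLUB_compl hs
  rw [← range_comp] at h
  have hc : ∀ᶠ w in generic M, ∀ n, value w (compl (a n)) = 1 - value w (a n) :=
    eventually_countable_forall.2 fun n => hR.eventually_value_compl (a n)
  filter_upwards [hR.eventually_tendsto_of_isLUB (fun i j hij => compl_anti (ha hij)) h, hc,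
    hR.eventually_value_compl s] with w h1 h2 h3
  have h4 := h1.const_sub 1
  simpa [h2, h3] using h4

section

variable {f : ℝ → M} (hf : Monotone f) (hbot : IsGLB (range f) 0) (htop : IsLUB (range f) 1)
  (hright : ∀ s, IsGLB (f '' Ioi s) (f s))

include hf

include hright in
theorem RieszDecomposition.eventually_tendsto_right {t : ℝ} {u : ℕ → ℚ} (hu : StrictAnti u)
    (hut : ∀ n, t < u n) (hlim : Tendsto (fun n => (u n : ℝ)) atTop (𝓝 t)) :
    ∀ᶠ w in generic M, Tendsto (fun n => value w (f (u n))) atTop (𝓝 (value w (f t))) := by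
  refine hR.eventually_tendsto_of_isGLB (a := fun n => f (u n))
    (fun i j hij => hf (by exact_mod_cast hu.antitone hij)) ⟨?_, fun z hz => (hright t).2 ?_⟩
  · rintro _ ⟨n, rfl⟩
    exact hf (hut n).le
  · rintro _ ⟨s, hs, rfl⟩
    obtain ⟨n, hn⟩ := (hlim.eventually_lt_const hs).exists
    exact (hz ⟨n, rfl⟩).trans (hf hn.le)

include hbot htop hright

/-- Working at rational points leaves only countably many generic conditions, which therefore hold
simultaneously. -/
theorem RieszDecomposition.eventually_isRatStieltjesPoint :
    ∀ᶠ w in generic M, IsRatStieltjesPoint (fun (w : Path M) (q : ℚ) => value w (f q)) w := by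
  have hmono := hR.eventually_monotone (a := fun q : ℚ => f q)
    fun p q hpq => hf (by exact_mod_cast hpq)
  have htop' : ∀ᶠ w in generic M,
      Tendsto (fun n : ℕ => value w (f n)) atTop (𝓝 (value w 1)) := by
    refine hR.eventually_tendsto_of_isLUB (a := fun n : ℕ => f n)
      (fun i j hij => hf (by exact_mod_cast hij)) ⟨fun x _ => EffectAlgebra.le_one x, ?_⟩
    intro z hz
    refine htop.2 ?_
    rintro _ ⟨t, rfl⟩
    obtain ⟨n, hn⟩ := exists_nat_ge t
    exact (hf hn).trans (hz ⟨n, rfl⟩)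
  have hbot' : ∀ᶠ w in generic M,
      Tendsto (fun n : ℕ => value w (f (-n))) atTop (𝓝 (value w 0)) := by
    refine hR.eventually_tendsto_of_isGLB (a := fun n : ℕ => f (-n))
      (fun i j hij => hf (neg_le_neg (by exact_mod_cast hij)))
      ⟨by rintro x -; exact EffectAlgebra.zero_le x, ?_⟩
    intro z hz
    refine hbot.2 ?_
    rintro _ ⟨t, rfl⟩
    obtain ⟨n, hn⟩ := exists_nat_ge (-t)
    exact (hz ⟨n, rfl⟩).trans (hf (by linarith))
  choose u hu hut hlim using fun q : ℚ => Real.exists_seq_rat_strictAnti_tendsto (q : ℝ)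
  have hr : ∀ᶠ w in generic M, ∀ q : ℚ,
      Tendsto (fun n => value w (f (u q n))) atTop (𝓝 (value w (f q))) :=
    eventually_countable_forall.2 fun q =>
      hR.eventually_tendsto_right hf hright (hu q) (hut q) (hlim q)
  filter_upwards [hmono, htop', hbot', hr] with w h1 h2 h3 h4
  rw [hR.value_one] at h2
  rw [hR.value_zero] at h3
  refine ⟨h1, tendsto_atTop_isLUB h1 ⟨?_, fun b hb => ?_⟩,
    tendsto_atBot_isGLB h1 ⟨?_, fun b hb => ?_⟩, fun q => ?_⟩
  · rintro _ ⟨q, rfl⟩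
    exact hR.value_le_one w _
  · exact le_of_tendsto' h2 fun n => hb ⟨n, by simp⟩
  · rintro _ ⟨q, rfl⟩
    exact hR.value_nonneg w _
  · exact ge_of_tendsto' h3 fun n => hb ⟨-n, by simp⟩
  · have hbdd : BddBelow (range fun r : Ioi q => value w (f (r : ℚ))) :=
      ⟨0, by rintro _ ⟨r, rfl⟩; exact hR.value_nonneg w _⟩
    have hne : Nonempty (Ioi q) := ⟨⟨q + 1, by simp⟩⟩
    refine le_antisymm (ge_of_tendsto' (h4 q) fun n => ?_) (le_ciInf fun r => h1 (le_of_lt r.2))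
    exact ciInf_le hbdd ⟨u q n, by exact_mod_cast hut q n⟩

/-- Along generic paths, the values of a right-continuous system are the distribution function of
a probability measure. -/
theorem RieszDecomposition.exists_measures :
    ∃ μ : Path M → Measure ℝ, (∀ w, IsProbabilityMeasure (μ w)) ∧
      ∀ t, ∀ᶠ w in generic M, (μ w).real (Iic t) = value w (f t) := by
  -- The discrete σ-algebra makes measurability in w vacuous. At non-generic w the construction uses
  -- a default distribution function, so every μ w is a probability measure.
  let _ : MeasurableSpace (Path M) := ⊤
  have hmeas : Measurable fun (w : Path M) (q : ℚ) => value w (f q) := measurable_from_top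
  refine ⟨fun w => (stieltjesOfMeasurableRat _ hmeas w).measure, fun w => inferInstance,
    fun t => ?_⟩
  obtain ⟨u, hu, hut, hlim⟩ := Real.exists_seq_rat_strictAnti_tendsto t
  filter_upwards [hR.eventually_isRatStieltjesPoint hf hbot htop hright,
    hR.eventually_tendsto_right hf hright hu hut hlim] with w h1 h2
  rw [Measure.real, measure_stieltjesOfMeasurableRat_Iic,
    ENNReal.toReal_ofReal (stieltjesOfMeasurableRat_nonneg hmeas w t)]
  have h3 : Tendsto (fun n => stieltjesOfMeasurableRat _ hmeas w (u n)) atTop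
      (𝓝 (stieltjesOfMeasurableRat _ hmeas w t)) :=
    ((stieltjesOfMeasurableRat _ hmeas w).right_continuous t).tendsto.comp
      (tendsto_nhdsWithin_iff.2 ⟨hlim, Eventually.of_forall fun n => (hut n).le⟩)
  refine tendsto_nhds_unique h3 ?_
  simpa only [stieltjesOfMeasurableRat_eq, toRatCDF_of_isRatStieltjesPoint h1] using h2

end

section

variable {μ : Path M → Measure ℝ} [hμ : ∀ w, IsProbabilityMeasure (μ w)]

theorem RieszDecomposition.represents_le {A B : Set ℝ} {a b : M} (hA : Represents μ A a)
    (hB : Represents μ B b) (hAB : A ⊆ B) : a ≤ b := by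
  refine hR.le_of_eventually ?_
  filter_upwards [hA, hB] with w h1 h2
  rw [← h1, ← h2]
  exact measureReal_mono hAB

theorem RieszDecomposition.represents_unique {A : Set ℝ} {a b : M} (ha : Represents μ A a)
    (hb : Represents μ A b) : a = b :=
  le_antisymm (hR.represents_le ha hb subset_rfl) (hR.represents_le hb ha subset_rfl)

/-- The sum is defined because μ(A) + μ(B) ≤ 1 generically, which says that a lies below the
supplement of b. -/
theorem RieszDecomposition.represents_union {A B : Set ℝ} {a b : M} (hA : Represents μ A a)
    (hB : Represents μ B b) (hAB : Disjoint A B) (hBm : MeasurableSet B) :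
    ∃ c, of a + of b = of c ∧ Represents μ (A ∪ B) c := by
  have hle : a ≤ compl b := by
    refine hR.le_of_eventually ?_
    filter_upwards [hA, hB, hR.eventually_value_compl b] with w h1 h2 h3
    rw [h3, ← h1, ← h2, le_sub_iff_add_le, ← measureReal_union hAB hBm]
    exact measureReal_le_one
  obtain ⟨c, hc⟩ := le_compl_iff.1 hle
  refine ⟨c, hc, ?_⟩
  filter_upwards [hA, hB, hR.eventually_value_add hc] with w h1 h2 h3
  rw [← h3, ← h1, ← h2, measureReal_union hAB hBm]

theorem RieszDecomposition.represents_iUnion {A : ℕ → Set ℝ} {a : ℕ → M} {s : M}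
    (hA : ∀ i, Represents μ (A i) (a i)) (hmono : Monotone A) (hs : IsLUB (range a) s) :
    Represents μ (⋃ i, A i) s := by
  have ha : Monotone a := fun i j hij => hR.represents_le (hA i) (hA j) (hmono hij)
  filter_upwards [hR.eventually_tendsto_of_isLUB ha hs, eventually_countable_forall.2 hA]
    with w h1 h2
  have h3 : Tendsto (fun i => (μ w).real (A i)) atTop (𝓝 ((μ w).real (⋃ i, A i))) :=
    (ENNReal.tendsto_toReal (measure_ne_top _ _)).comp (tendsto_measure_iUnion_atTop hmono)
  simp only [h2] at h3
  exact tendsto_nhds_unique h3 h1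

theorem RieszDecomposition.exists_represents (h : ∀ t, ∃ a, Represents μ (Iic t) a) (A : Set ℝ)
    (hA : MeasurableSet A) : ∃ a, Represents μ A a := by
  refine MeasurableSpace.induction_on_inter (C := fun A _ => ∃ a, Represents μ A a)
    ((BorelSpace.measurable_eq (α := ℝ)).trans (borel_eq_generateFrom_Iic ℝ))
    isPiSystem_Iic ?_ ?_ ?_ ?_ A hA
  · exact ⟨0, Eventually.of_forall fun w => by simp [hR.value_zero]⟩
  · rintro _ ⟨t, rfl⟩
    exact h t
  · rintro B hB ⟨b, hb⟩
    refine ⟨compl b, ?_⟩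
    filter_upwards [hb, hR.eventually_value_compl b] with w h1 h2
    rw [h2, ← h1, probReal_compl_eq_one_sub hB]
  · intro B hd hB hrep
    -- Finite partial unions reduce a disjoint union to an increasing one, whose element is a
    -- countable join.
    have hacc : ∀ n, ∃ s, Represents μ (accumulate B n) s := by
      intro n
      induction n with
      | zero => simpa using hrep 0
      | succ n ih =>
        obtain ⟨s, hs⟩ := ih
        obtain ⟨b, hb⟩ := hrep (n + 1)
        obtain ⟨c, -, hc⟩ := hR.represents_union hs hb
          (disjoint_accumulate hd n.lt_succ_self) (hB _)
        rw [accumulate_succ]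
        exact ⟨c, hc⟩
    choose s hs using hacc
    obtain ⟨t, ht⟩ := IsSigmaLatticeEffectAlgebra.exists_isLUB s
    refine ⟨t, ?_⟩
    rw [← iUnion_accumulate]
    exact hR.represents_iUnion hs monotone_accumulate ht

end

/-- In a `σ`-lattice effect algebra with the Riesz decomposition property, every right-continuous
system is the system of an observable. -/
theorem RieszDecomposition.exists_observable {f : ℝ → M} (hf : Monotone f)
    (hbot : IsGLB (range f) 0) (htop : IsLUB (range f) 1)
    (hright : ∀ s, IsGLB (f '' Ioi s) (f s)) :
    ∃ x : Observable M, ∀ t, f t = x.toFun (Iic t) measurableSet_Iic := by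
  obtain ⟨μ, hμ, hμf⟩ := hR.exists_measures hf hbot htop hright
  choose x hx using hR.exists_represents (μ := μ) fun t => ⟨f t, hμf t⟩
  refine ⟨⟨x, ?_, ?_, ?_⟩, fun t => hR.represents_unique (hμf t) (hx _ _)⟩
  · refine hR.represents_unique (hx _ _) (Eventually.of_forall fun w => ?_)
    simp [hR.value_one]
  · intro A B hA hB hAB
    obtain ⟨c, hc, hcr⟩ := hR.represents_union (hx A hA) (hx B hB)
      (disjoint_iff_inter_eq_empty.2 hAB) hB
    rw [hR.represents_unique (hx _ (hA.union hB)) hcr]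
    exact hc
  · intro A hA hAA
    obtain ⟨s, hs⟩ := IsSigmaLatticeEffectAlgebra.exists_isLUB fun i => x (A i) (hA i)
    have h := hR.represents_iUnion (fun i => hx (A i) (hA i)) (monotone_nat_of_le_succ hAA) hs
    rw [hR.represents_unique (hx _ (MeasurableSet.iUnion hA)) h]
    exact hs

end Measures

open Set

/-! ### Observables on half-lines and transfer from a block -/

section Observables

variable {E : Type*} [EffectAlgebra E]

theorem _root_.Observable.congr_set (x : Observable E) {A B : Set ℝ} (hA : MeasurableSet A)
    (hB : MeasurableSet B) (h : A = B) : x.toFun A hA = x.toFun B hB := by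
  subst h; rfl

theorem _root_.Observable.add_of_disjoint (x : Observable E) {A B C : Set ℝ}
    (hA : MeasurableSet A) (hB : MeasurableSet B) (hC : MeasurableSet C) (hAB : Disjoint A B)
    (h : A ∪ B = C) : of (x.toFun A hA) + of (x.toFun B hB) = of (x.toFun C hC) := by
  subst h
  exact x.map_union A B hA hB (disjoint_iff_inter_eq_empty.1 hAB)

theorem _root_.Observable.mono (x : Observable E) {A B : Set ℝ} (hA : MeasurableSet A)
    (hB : MeasurableSet B) (h : A ⊆ B) : x.toFun A hA ≤ x.toFun B hB :=
  le_of_add (x.add_of_disjoint hA (hB.diff hA) hB disjoint_sdiff_right (union_sdiff_cancel h))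

theorem _root_.Observable.map_compl (x : Observable E) {A : Set ℝ} (hA : MeasurableSet A) :
    x.toFun Aᶜ hA.compl = compl (x.toFun A hA) := by
  have h := x.add_of_disjoint hA hA.compl MeasurableSet.univ disjoint_compl_right
    (union_compl_self A)
  rw [x.map_univ] at h
  exact compl_unique h (add_compl _)

theorem _root_.Observable.map_empty (x : Observable E) : x.toFun ∅ MeasurableSet.empty = 0 := by
  rw [x.congr_set MeasurableSet.empty MeasurableSet.univ.compl compl_univ.symm,
    x.map_compl MeasurableSet.univ,
    x.map_univ, ← compl_zero, compl_compl]

theorem _root_.Observable.map_iInter (x : Observable E) {A : ℕ → Set ℝ}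
    (hA : ∀ i, MeasurableSet (A i)) (h : Antitone A) :
    IsGLB (range fun i => x.toFun (A i) (hA i)) (x.toFun (⋂ i, A i) (MeasurableSet.iInter hA)) := by
  have h1 := isGLB_compl (x.map_iUnion (fun i => (A i)ᶜ) (fun i => (hA i).compl)
    fun i => compl_subset_compl.2 (h i.le_succ))
  rw [← range_comp] at h1
  convert h1 using 1
  · congr 1
    ext i
    rw [Function.comp, x.map_compl (hA i), compl_compl]
  · rw [x.congr_set _ (MeasurableSet.iInter hA).compl (compl_iInter A).symm,
      x.map_compl (MeasurableSet.iInter hA),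
      compl_compl]

/-- An observable is determined by its values on the half-lines. -/
theorem _root_.Observable.ext_of_Iic {x y : Observable E}
    (h : ∀ t, x.toFun (Iic t) measurableSet_Iic = y.toFun (Iic t) measurableSet_Iic) : x = y := by
  ext A hA
  refine MeasurableSpace.induction_on_inter (C := fun A hA => x.toFun A hA = y.toFun A hA)
    ((BorelSpace.measurable_eq (α := ℝ)).trans (borel_eq_generateFrom_Iic ℝ))
    isPiSystem_Iic ?_ ?_ ?_ ?_ A hA
  · rw [x.map_empty, y.map_empty]
  · rintro _ ⟨t, rfl⟩
    exact h t
  · intro B hB hxy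
    rw [x.map_compl hB, y.map_compl hB, hxy]
  · intro B hd hB hxy
    have hm : ∀ n, MeasurableSet (accumulate B n) := fun n =>
      MeasurableSet.biUnion (to_countable _) fun i _ => hB i
    have hacc : ∀ n, x.toFun (accumulate B n) (hm n) = y.toFun (accumulate B n) (hm n) := by
      intro n
      induction n with
      | zero =>
        rw [x.congr_set _ (hB 0) (accumulate_zero_nat B),
          y.congr_set _ (hB 0) (accumulate_zero_nat B), hxy]
      | succ n ih =>
        have hdn := disjoint_accumulate hd n.lt_succ_self
        have h1 := x.add_of_disjoint (hm n) (hB (n + 1)) (hm (n + 1)) hdn (accumulate_succ B n).symm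
        have h2 := y.add_of_disjoint (hm n) (hB (n + 1)) (hm (n + 1)) hdn (accumulate_succ B n).symm
        rw [ih, hxy] at h1
        exact of_injective (h1.symm.trans h2)
    have h1 := x.map_iUnion _ hm fun i => monotone_accumulate i.le_succ
    have h2 := y.map_iUnion _ hm fun i => monotone_accumulate i.le_succ
    simp only [hacc] at h1
    have h3 := h1.unique h2
    rwa [x.congr_set _ (MeasurableSet.iUnion hB) iUnion_accumulate,
      y.congr_set _ (MeasurableSet.iUnion hB) iUnion_accumulate] at h3

theorem _root_.Observable.isGLB_range_Iic (x : Observable E) :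
    IsGLB (range fun t => x.toFun (Iic t) measurableSet_Iic) 0 := by
  refine ⟨fun a _ => EffectAlgebra.zero_le a, fun z hz => ?_⟩
  have h := x.map_iInter (A := fun n : ℕ => Iic (-n : ℝ)) (fun _ => measurableSet_Iic)
    fun i j hij => Iic_subset_Iic.2 (neg_le_neg (by exact_mod_cast hij))
  have he : ⋂ n : ℕ, Iic (-n : ℝ) = ∅ := by
    refine eq_empty_of_forall_notMem fun t ht => ?_
    obtain ⟨n, hn⟩ := exists_nat_gt (-t)
    have := mem_iInter.1 ht n
    rw [mem_Iic] at this
    linarith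
  rw [← x.map_empty, ← x.congr_set (MeasurableSet.iInter fun _ => measurableSet_Iic) _ he]
  refine h.2 ?_
  rintro _ ⟨n, rfl⟩
  exact hz ⟨-n, rfl⟩

theorem _root_.Observable.isLUB_range_Iic (x : Observable E) :
    IsLUB (range fun t => x.toFun (Iic t) measurableSet_Iic) 1 := by
  refine ⟨fun a _ => EffectAlgebra.le_one a, fun z hz => ?_⟩
  have h := x.map_iUnion (fun n : ℕ => Iic (n : ℝ)) (fun _ => measurableSet_Iic)
    fun i => Iic_subset_Iic.2 (by exact_mod_cast i.le_succ)
  have he : ⋃ n : ℕ, Iic (n : ℝ) = univ := by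
    refine eq_univ_of_forall fun t => ?_
    obtain ⟨n, hn⟩ := exists_nat_ge t
    exact mem_iUnion.2 ⟨n, hn⟩
  rw [← x.map_univ, ← x.congr_set (MeasurableSet.iUnion fun _ => measurableSet_Iic) _ he]
  refine h.2 ?_
  rintro _ ⟨n, rfl⟩
  exact hz ⟨n, rfl⟩

theorem _root_.Observable.isGLB_image_Iic (x : Observable E) (s : ℝ) :
    IsGLB ((fun t => x.toFun (Iic t) measurableSet_Iic) '' Ioi s)
      (x.toFun (Iic s) measurableSet_Iic) := by
  refine ⟨?_, fun z hz => ?_⟩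
  · rintro _ ⟨t, ht, rfl⟩
    exact x.mono _ _ (Iic_subset_Iic.2 (le_of_lt ht))
  obtain ⟨u, hu, hus, hlim⟩ := exists_seq_strictAnti_tendsto s
  have h := x.map_iInter (A := fun n : ℕ => Iic (u n)) (fun _ => measurableSet_Iic)
    fun i j hij => Iic_subset_Iic.2 (hu.antitone hij)
  have he : ⋂ n : ℕ, Iic (u n) = Iic s := by
    ext t
    simp only [mem_iInter, mem_Iic]
    exact ⟨fun ht => ge_of_tendsto' hlim ht, fun ht n => ht.trans (hus n).le⟩
  rw [← x.congr_set (MeasurableSet.iInter fun _ => measurableSet_Iic) _ he]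
  refine h.2 ?_
  rintro _ ⟨n, rfl⟩
  exact hz ⟨u n, hus n, rfl⟩

/-- The block observable is also one on E because sums and joins of sequences in the block agree
with those of E. -/
theorem exists_observable [IsSigmaLatticeEffectAlgebra E] {f : ℝ → E} (hf : Monotone f)
    (hbot : IsGLB (range f) 0) (htop : IsLUB (range f) 1)
    (hright : ∀ s, IsGLB (f '' Ioi s) (f s)) :
    ∃ x : Observable E, ∀ t, f t = x.toFun (Iic t) measurableSet_Iic := by
  obtain ⟨M, hM, hfM⟩ := exists_isBlock (s := range f) (by
    rintro _ ⟨s, rfl⟩ _ ⟨t, rfl⟩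
    rcases le_total s t with h | h
    exacts [Compat.of_le (hf h), (Compat.of_le (hf h)).symm])
  let _ := blockEffectAlgebra hM
  have _ := block_isSigmaLattice hM
  let g : ℝ → Block M := fun t => ⟨f t, hfM ⟨t, rfl⟩⟩
  obtain ⟨x, hx⟩ := (block_rieszDecomposition hM).exists_observable (f := g)
    (fun s t hst => (block_le_iff hM).2 (hf hst)) (block_isGLB hM (s := 0) hbot)
    (block_isLUB hM (s := 1) htop) (fun s => by
      rw [image_eq_range]
      refine block_isGLB hM ?_
      have h := hright s
      rwa [image_eq_range] at h)
  exact ⟨⟨fun A hA => (x.toFun A hA).val, congrArg Block.val x.map_univ,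
    fun A B hA hB hAB => (block_add_iff hM).1 (x.map_union A B hA hB hAB),
    fun A hA hAA => isLUB_of_block hM (x.map_iUnion A hA hAA)⟩,
    fun t => congrArg Block.val (hx t)⟩

end Observables

end EffectAlgebra

theorem theorem4p1 {E : Type*} [EffectAlgebra E] [IsSigmaLatticeEffectAlgebra E] :
    (∀ (x : Observable E) (f : ℝ → E), (∀ t : ℝ, f t = x.toFun (Set.Iic t) measurableSet_Iic) →
      (∀ t s : ℝ, t < s → f t ≤ f s) ∧
      IsGLB (Set.range f) 0 ∧ IsLUB (Set.range f) 1 ∧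
      (∀ s : ℝ, IsGLB (f '' Set.Ioi s) (f s))) ∧
    (∀ f : ℝ → E,
      (∀ t s : ℝ, t < s → f t ≤ f s) →
      IsGLB (Set.range f) 0 → IsLUB (Set.range f) 1 →
      (∀ s : ℝ, IsGLB (f '' Set.Ioi s) (f s)) →
      ∃! x : Observable E, ∀ t : ℝ, f t = x.toFun (Set.Iic t) measurableSet_Iic) := by
  refine ⟨fun x f hf => ?_, fun f hf hbot htop hright => ?_⟩
  · obtain rfl : f = fun t => x.toFun (Set.Iic t) measurableSet_Iic := funext hf
    exact ⟨fun t s hts => x.mono _ _ (Set.Iic_subset_Iic.2 hts.le), x.isGLB_range_Iic,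
      x.isLUB_range_Iic, x.isGLB_image_Iic⟩
  · obtain ⟨x, hx⟩ := EffectAlgebra.exists_observable
      (fun s t hst => hst.eq_or_lt.elim (fun h => h ▸ le_rfl) (hf s t)) hbot htop hright
    exact ⟨x, hx, fun y hy => Observable.ext_of_Iic fun t => (hy t).symm.trans (hx t)⟩
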